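/- **Setting.** Let $H$ and $Y$ be complex Hilbert spaces and let $P$ be a nonnegative self-adjoint operator on $H$ with compact resolvent. For $s\in\mathbb R$ let $\Lambda^s=(1+P)^s$ be defined by the spectral resolution of $P$, and let $H_s=\Lambda^{-s}(H)$ with the norm $\|u\|_s=\|\Lambda^s u\|_H$, so that $H_0=H$, $H_1$ is the domain of $P$, and $H_{-s}$ is the dual of $H_s$ with respect to the inner product of $H$. Let $\gamma\in[0,\frac12]$, let $Q\in\mathcal L(H_\gamma,Y)$, and let $Q^*\in\mathcal L(Y,H_{-\gamma})$ be its adjoint with respect to this duality. On $\mathcal H=H_{1/2}\times H$, with norm $\|(u,v)\|_{\mathcal H}^2=\|u\|_{1/2}^2+\|v\|_H^2$, let $\mathcal A$ be the operator $\mathcal A(u,v)=(v,\,-(Pu+Q^*Qv))$ with domain $\{(u,v)\in H_{1/2}\times H_{1/2}: Pu+Q^*Qv\in H\}$. Write $\langle\lambda\rangle=(1+\lambda^2)^{1/2}$. A bound $\|(\mathcal A+i\lambda)^{-1}\|\le K$ includes the assertion that $\mathcal A+i\lambda$ is invertible, and the norm is the operator norm on $\mathcal H$. **Control estimate.** Let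 $\mu\ge 0$ and let $M,m$ be continuous functions on $[0,\infty)$ that are bounded below by a positive constant. The control estimate holds for $P$ and $Q$ with parameter $\mu$ and functions $M,m$ if there are $\lambda_0\ge0$, $N>0$ and $C$ such that $$\|u\|_{H}\le M(\lambda)\langle \lambda\rangle^{-1}\|(P-\lambda^2)\Lambda^{\mu-\gamma} u\|_{H}+m(\lambda)\|Q \Lambda^{\mu} u\|_{Y}+C\|\Lambda^{-N} u\|_{H}$$ for all $u\in H_{1+\mu-\gamma}$ and all $\lambda\ge\lambda_0$. **Theorem (Control and stability).** 1. Suppose the control estimate holds for $P$ and $Q$ with parameter $\mu\ge0$ and functions $M,m$. Then there exist $\lambda_0'>0$ and $C>0$ such that $$\|(\mathcal{A}+i\lambda)^{-1}\|\le C|\lambda|^{4\mu}\left(M(|\lambda|)^2+m(|\lambda|)^2\right)$$ for all $\lambda\in\mathbb R$ with $|\lambda|\ge\lambda_0'$. 2. Let $\lambda_0\ge0$ and let $K$ be a real function with $K(t)\ge C'$ for all $t\ge\lambda_0$ and some $C'>0$. Suppose $\|(\mathcal A+i\lambda)^{-1}\|\le K(|\lambda|)$ for all $\lambda\in\mathbb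 R$ with $|\lambda|\ge\lambda_0$. Then for every $\mu\in[0,\frac12+\gamma]$ there exists $C>0$ such that $$\|u\|_{H}\le C\langle \lambda\rangle^{2(\gamma-\mu)}K(|\lambda|)\left(\langle \lambda\rangle^{-1}\|(P-\lambda^2)\Lambda^{\mu-\gamma}u\|_{H}+\|Q\Lambda^{\mu}u\|_Y\right)$$ for all $\lambda\ge\lambda_0$ and all $u\in H_{\frac12+\mu}$, where the right-hand side is understood to be $+\infty$ if $(P-\lambda^2)\Lambda^{\mu-\gamma}u\notin H$. -/

import Mathlib

open scoped NNReal ENNReal InnerProductSpace ComplexInnerProductSpace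

noncomputable section

namespace DampedWave

/-- `A + z` is invertible, that is a bijection from the domain of `A` onto the whole space with
bounded inverse, and `‖(A + z)⁻¹‖ ≤ K`. -/
def ResolventBound {X : Type*} [NormedAddCommGroup X] [NormedSpace ℂ X] (A : X →ₗ.[ℂ] X)
    (z : ℂ) (K : ℝ) : Prop :=
  ∃ R : X →L[ℂ] X, ‖R‖ ≤ K ∧
    (∀ f : X, ∃ h : R f ∈ A.domain, A ⟨R f, h⟩ + z • R f = f) ∧
    (∀ x : A.domain, R (A x + z • (x : X)) = x)

/-- A nonnegative self-adjoint (in particular densely defined) operator `P` with compact resolvent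
on a Hilbert space. As `P ≥ 0` is self-adjoint, `-1` lies in its resolvent set, and the compactness
of the resolvent is stated there: `(P + 1)⁻¹` is a compact operator. -/
structure NonnegOperator (H : Type*) [NormedAddCommGroup H] [InnerProductSpace ℂ H]
    [CompleteSpace H] where
  op : H →ₗ.[ℂ] H
  selfAdjoint : IsSelfAdjoint op
  nonneg : ∀ x : op.domain, 0 ≤ (⟪op x, (x : H)⟫_ℂ).re
  compact_resolvent : ∃ R : H →L[ℂ] H, IsCompactOperator R ∧
    (∀ f : H, ∃ h : R f ∈ op.domain, op ⟨R f, h⟩ + R f = f) ∧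
    (∀ x : op.domain, R (op x + (x : H)) = x)

namespace NonnegOperator

variable {H : Type*} [NormedAddCommGroup H] [InnerProductSpace ℂ H] [CompleteSpace H]
variable (P : NonnegOperator H)

/-- The eigenspace of `P` for the eigenvalue `κ ≥ 0` (zero if `κ` is not an eigenvalue). -/
def eigenspace (κ : ℝ≥0) : Submodule ℂ H where
  carrier := {x | ∃ h : x ∈ P.op.domain, P.op ⟨x, h⟩ = ((κ : ℝ) : ℂ) • x}
  zero_mem' := ⟨P.op.domain.zero_mem, by
    rw [smul_zero]; exact P.op.map_zero⟩
  add_mem' := by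
    rintro x y ⟨hx, ex⟩ ⟨hy, ey⟩
    refine ⟨P.op.domain.add_mem hx hy, ?_⟩
    rw [smul_add, ← ex, ← ey, ← P.op.map_add]
    rfl
  smul_mem' := by
    rintro c x ⟨hx, ex⟩
    refine ⟨P.op.domain.smul_mem c hx, ?_⟩
    rw [smul_comm, ← ex, ← P.op.map_smul]
    rfl

/-- Formal eigenfunction expansions: families `(u_κ)` with `u_κ` in the eigenspace of `P` for `κ`.
Because the resolvent of `P` is compact, the spectral resolution of `P` is the family of orthogonal
projections onto these eigenspaces (`κ = ρ ^ 2`); an expansion stands for `∑ u_κ`. All spaces `H_s`,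
`s : ℝ`, live inside this space. -/
def Expansion : Type _ := ∀ κ : ℝ≥0, P.eigenspace κ

instance : AddCommGroup P.Expansion := inferInstanceAs (AddCommGroup (∀ κ, P.eigenspace κ))

instance : Module ℂ P.Expansion := inferInstanceAs (Module ℂ (∀ κ, P.eigenspace κ))

/-- The function `f(P)` of `P`, acting on expansions: `u_κ` is multiplied by `f κ`. -/
def fn (f : ℝ → ℝ) : P.Expansion →ₗ[ℂ] P.Expansion where
  toFun u := fun κ => ((f κ : ℝ) : ℂ) • u κ
  map_add' u v := by funext κ; exact smul_add _ _ _
  map_smul' c u := by funext κ; exact smul_comm ((f κ : ℝ) : ℂ) c (u κ)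

/-- `Λ ^ s = (1 + P) ^ s`. -/
def Lam (s : ℝ) : P.Expansion →ₗ[ℂ] P.Expansion := P.fn fun κ => (1 + κ) ^ s

/-- The operator `P` on expansions, extending `P` from `H_1` to all spaces `H_s`. -/
def opP : P.Expansion →ₗ[ℂ] P.Expansion := P.fn fun κ => κ

/-- The operator `P - c` on expansions, for a real number `c`. -/
def opSub (c : ℝ) : P.Expansion →ₗ[ℂ] P.Expansion := P.fn fun κ => κ - c

/-- The space `H_s = Λ ^ (-s) H`, for all `s : ℝ`: the expansions `u` with
`∑ (1 + κ) ^ (2 s) ‖u_κ‖ ^ 2 < ∞`. The space `H` itself is identified with `H_0`, see `expand`. -/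
def Hs (s : ℝ) : Submodule ℂ P.Expansion where
  carrier := {u | Memℓp (fun κ => P.Lam s u κ) 2}
  zero_mem' := by
    rw [Set.mem_ofPred_eq, map_zero]; exact zero_memℓp
  add_mem' := by
    intro u v hu hv
    rw [Set.mem_ofPred_eq, map_add]; exact Memℓp.add hu hv
  smul_mem' := by
    intro c u hu
    rw [Set.mem_ofPred_eq, map_smul]; exact Memℓp.const_smul hu c

/-- `Λ ^ s` as a linear bijection from `H_s` onto the Hilbert sum of the eigenspaces. -/
def toSum (s : ℝ) : P.Hs s →ₗ[ℂ] lp (fun κ => P.eigenspace κ) 2 where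
  toFun u := ⟨fun κ => P.Lam s u κ, u.2⟩
  map_add' u v := by ext1; exact map_add (P.Lam s) (u : P.Expansion) v
  map_smul' c u := by ext1; exact map_smul (P.Lam s) c (u : P.Expansion)

lemma opSub_zero (u : P.Expansion) : P.opSub 0 u = P.opP u := by
  funext κ
  change (((κ : ℝ) - 0 : ℝ) : ℂ) • u κ = (((κ : ℝ) : ℝ) : ℂ) • u κ
  rw [sub_zero]

lemma weight_pos (κ : ℝ≥0) (s : ℝ) : 0 < (1 + (κ : ℝ)) ^ s :=
  Real.rpow_pos_of_pos (by positivity) s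

lemma Lam_Lam (r s : ℝ) (u : P.Expansion) : P.Lam r (P.Lam s u) = P.Lam (r + s) u := by
  funext κ
  change (((1 + (κ : ℝ)) ^ r : ℝ) : ℂ) • (((1 + (κ : ℝ)) ^ s : ℝ) : ℂ) • u κ
    = (((1 + (κ : ℝ)) ^ (r + s) : ℝ) : ℂ) • u κ
  rw [smul_smul, Real.rpow_add (by positivity), Complex.ofReal_mul]

lemma Lam_zero (u : P.Expansion) : P.Lam 0 u = u := by
  funext κ
  change (((1 + (κ : ℝ)) ^ (0 : ℝ) : ℝ) : ℂ) • u κ = u κ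
  simp

lemma toSum_injective (s : ℝ) : Function.Injective (P.toSum s) := by
  intro u v h
  have h1 : P.Lam s u = P.Lam s v := congrArg Subtype.val h
  have h2 := congrArg (P.Lam (-s)) h1
  rw [Lam_Lam, Lam_Lam, neg_add_cancel, Lam_zero, Lam_zero] at h2
  exact Subtype.ext h2

lemma toSum_surjective (s : ℝ) : Function.Surjective (P.toSum s) := by
  intro f
  let g : P.Expansion := (f : ∀ κ, P.eigenspace κ)
  have h : P.Lam s (P.Lam (-s) g) = g := by
    rw [Lam_Lam, add_neg_cancel, Lam_zero]
  refine ⟨⟨P.Lam (-s) g, ?_⟩, ?_⟩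
  · change Memℓp (fun κ => P.Lam s (P.Lam (-s) g) κ) 2
    rw [h]; exact f.2
  · ext1; exact h

/-- The norm `‖u‖_s = ‖Λ ^ s u‖ = (∑ (1 + κ) ^ (2 s) ‖u_κ‖ ^ 2) ^ (1 / 2)` of `H_s`. -/
instance (s : ℝ) : NormedAddCommGroup (P.Hs s) :=
  NormedAddCommGroup.induced _ _ (P.toSum s) (P.toSum_injective s)

lemma norm_def (s : ℝ) (u : P.Hs s) : ‖u‖ = ‖P.toSum s u‖ := rfl

instance (s : ℝ) : InnerProductSpace ℂ (P.Hs s) where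
  norm_smul_le c u := by
    rw [norm_def, norm_def, map_smul, norm_smul]
  inner u v := ⟪P.toSum s u, P.toSum s v⟫_ℂ
  norm_sq_eq_re_inner u := by
    rw [norm_def]; exact norm_sq_eq_re_inner (𝕜 := ℂ) _
  conj_inner_symm u v := inner_conj_symm _ _
  add_left u v w := by rw [map_add, inner_add_left]
  smul_left u v c := by rw [map_smul, inner_smul_left]

/-- `Λ ^ s` is a unitary map from `H_s` onto the Hilbert sum of the eigenspaces. -/
def sumEquiv (s : ℝ) : P.Hs s ≃ₗᵢ[ℂ] lp (fun κ => P.eigenspace κ) 2 where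
  toLinearEquiv := LinearEquiv.ofBijective (P.toSum s) ⟨P.toSum_injective s, P.toSum_surjective s⟩
  norm_map' _ := rfl

lemma isClosed_eigenspace (κ : ℝ≥0) : IsClosed (P.eigenspace κ : Set H) := by
  have hc : IsClosed (P.op.graph : Set (H × H)) := P.selfAdjoint.isClosed
  have : (P.eigenspace κ : Set H) =
      (fun x : H => (x, ((κ : ℝ) : ℂ) • x)) ⁻¹' (P.op.graph : Set (H × H)) := by
    ext x
    simp only [Set.mem_preimage, SetLike.mem_coe, LinearPMap.mem_graph_iff]
    constructor
    · rintro ⟨h, e⟩; exact ⟨⟨x, h⟩, rfl, e⟩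
    · rintro ⟨⟨y, hy⟩, e1, e2⟩
      simp only at e1
      subst e1
      exact ⟨hy, e2⟩
  rw [this]
  exact hc.preimage (by fun_prop)

instance (κ : ℝ≥0) : CompleteSpace (P.eigenspace κ) :=
  (P.isClosed_eigenspace κ).completeSpace_coe

instance (s : ℝ) : CompleteSpace (P.Hs s) :=
  (P.sumEquiv s).toIsometryEquiv.completeSpace_iff.mpr inferInstance

lemma memHs_of_le {s t C : ℝ} {u v : P.Expansion} (hu : u ∈ P.Hs s)
    (h : ∀ κ : ℝ≥0, (1 + (κ : ℝ)) ^ t * ‖v κ‖ ≤ C * ((1 + (κ : ℝ)) ^ s * ‖u κ‖)) :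
    v ∈ P.Hs t := by
  have key : ∀ (r : ℝ) (w : P.Expansion) (κ : ℝ≥0),
      ‖P.Lam r w κ‖ = (1 + (κ : ℝ)) ^ r * ‖w κ‖ := by
    intro r w κ
    change ‖(((1 + (κ : ℝ)) ^ r : ℝ) : ℂ) • w κ‖ = _
    rw [norm_smul, Complex.norm_real, Real.norm_of_nonneg (weight_pos κ r).le]
  have h2 : (0 : ℝ) < (2 : ℝ≥0∞).toReal := by norm_num
  change Memℓp (fun κ => P.Lam s u κ) 2 at hu
  change Memℓp (fun κ => P.Lam t v κ) 2
  rw [memℓp_gen_iff h2] at hu ⊢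
  refine Summable.of_nonneg_of_le (fun κ => by positivity) (fun κ => ?_)
    (hu.mul_left (|C| ^ (2 : ℝ≥0∞).toReal))
  rw [← Real.mul_rpow (abs_nonneg _) (norm_nonneg _)]
  refine Real.rpow_le_rpow (norm_nonneg _) ?_ h2.le
  have := h κ
  rw [← key, ← key] at this
  exact this.trans (mul_le_mul_of_nonneg_right (le_abs_self C) (norm_nonneg _))

/-- `Λ ^ r` maps `H_s` to `H_t` for `t + r ≤ s`. -/
lemma Lam_mem {r s t : ℝ} (h : t + r ≤ s) {u : P.Expansion} (hu : u ∈ P.Hs s) :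
    P.Lam r u ∈ P.Hs t := by
  refine P.memHs_of_le (C := 1) hu fun κ => ?_
  change (1 + (κ : ℝ)) ^ t * ‖(((1 + (κ : ℝ)) ^ r : ℝ) : ℂ) • u κ‖ ≤ _
  rw [norm_smul, Complex.norm_real, Real.norm_of_nonneg (weight_pos κ r).le, ← mul_assoc,
    ← Real.rpow_add (by positivity), one_mul]
  refine mul_le_mul_of_nonneg_right ?_ (norm_nonneg _)
  exact Real.rpow_le_rpow_of_exponent_le (by simp) h

/-- `P - c` maps `H_s` to `H_t` for `t + 1 ≤ s`. -/
lemma opSub_mem (c : ℝ) {s t : ℝ} (h : t + 1 ≤ s) {u : P.Expansion} (hu : u ∈ P.Hs s) :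
    P.opSub c u ∈ P.Hs t := by
  refine P.memHs_of_le (C := 1 + |c|) hu fun κ => ?_
  change (1 + (κ : ℝ)) ^ t * ‖(((κ : ℝ) - c : ℝ) : ℂ) • u κ‖ ≤ _
  have hκ : (0 : ℝ) ≤ κ := κ.2
  have h1 : |(κ : ℝ) - c| ≤ (1 + |c|) * (1 + κ) := by
    have := abs_sub (κ : ℝ) c
    rw [abs_of_nonneg hκ] at this
    nlinarith [abs_nonneg c]
  have h2 : (1 + (κ : ℝ)) ^ t * (1 + κ) ≤ (1 + (κ : ℝ)) ^ s := by
    calc (1 + (κ : ℝ)) ^ t * (1 + κ) = (1 + (κ : ℝ)) ^ (t + 1) := by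
          rw [Real.rpow_add (by positivity), Real.rpow_one]
      _ ≤ _ := Real.rpow_le_rpow_of_exponent_le (by simp) h
  rw [norm_smul, Complex.norm_real, Real.norm_eq_abs, ← mul_assoc, ← mul_assoc]
  refine mul_le_mul_of_nonneg_right ?_ (norm_nonneg _)
  calc (1 + (κ : ℝ)) ^ t * |(κ : ℝ) - c|
      ≤ (1 + (κ : ℝ)) ^ t * ((1 + |c|) * (1 + κ)) :=
        mul_le_mul_of_nonneg_left h1 (weight_pos κ t).le
    _ = (1 + |c|) * ((1 + (κ : ℝ)) ^ t * (1 + κ)) := by ring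
    _ ≤ _ := mul_le_mul_of_nonneg_left h2 (by positivity)

/-- `H_s ⊆ H_t` for `t ≤ s`. -/
lemma mem_of_le {s t : ℝ} (h : t ≤ s) {u : P.Expansion} (hu : u ∈ P.Hs s) : u ∈ P.Hs t := by
  have := P.Lam_mem (r := 0) (t := t) (by linarith) hu
  rwa [Lam_zero] at this

/-! ### The identification of `H` with `H_0` -/

lemma op_symm (x y : P.op.domain) : ⟪P.op x, (y : H)⟫_ℂ = ⟪(x : H), P.op y⟫_ℂ := by
  have h := LinearPMap.adjoint_isFormalAdjoint P.selfAdjoint.dense_domain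
  rw [LinearPMap.isSelfAdjoint_def.mp P.selfAdjoint] at h
  exact h x y

lemma orthogonalFamily : OrthogonalFamily ℂ (fun κ => P.eigenspace κ)
    fun κ => (P.eigenspace κ).subtypeₗᵢ := by
  rintro κ κ' hne ⟨x, hx, ex⟩ ⟨y, hy, ey⟩
  change ⟪x, y⟫_ℂ = 0
  have h := P.op_symm ⟨x, hx⟩ ⟨y, hy⟩
  rw [ex, ey] at h
  simp only [inner_smul_left, inner_smul_right, Complex.conj_ofReal] at h
  have h' : (((κ : ℝ) : ℂ) - ((κ' : ℝ) : ℂ)) * ⟪x, y⟫_ℂ = 0 := by rw [sub_mul, h, sub_self]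
  rcases mul_eq_zero.mp h' with h0 | h0
  · exact absurd (NNReal.coe_injective (Complex.ofReal_injective (sub_eq_zero.mp h0))) hne
  · exact h0

lemma isHilbertSum : IsHilbertSum ℂ (fun κ => P.eigenspace κ)
    fun κ => (P.eigenspace κ).subtypeₗᵢ := by
  refine IsHilbertSum.mkInternal (F := fun κ => P.eigenspace κ) P.orthogonalFamily ?_
  obtain ⟨R, hR, h1, h2⟩ := P.compact_resolvent
  have hsymm : (R : H →ₗ[ℂ] H).IsSymmetric := by
    intro f g
    obtain ⟨hf, ef⟩ := h1 f
    obtain ⟨hg, eg⟩ := h1 g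
    have := P.op_symm ⟨R f, hf⟩ ⟨R g, hg⟩
    change ⟪R f, g⟫_ℂ = ⟪f, R g⟫_ℂ
    conv_lhs => rw [← eg]
    conv_rhs => rw [← ef]
    rw [inner_add_left, inner_add_right, this]
  have hle : ∀ μ : ℂ, Module.End.eigenspace (R : H →ₗ[ℂ] H) μ ≤ ⨆ κ, P.eigenspace κ := by
    intro μ x hx
    rw [Module.End.mem_eigenspace_iff] at hx
    change R x = μ • x at hx
    by_cases hx0 : x = 0
    · rw [hx0]; exact Submodule.zero_mem _
    obtain ⟨hd, e⟩ := h1 x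
    have hμ : μ ≠ 0 := by
      rintro rfl
      rw [zero_smul] at hx
      have hz : (⟨R x, hd⟩ : P.op.domain) = 0 := Subtype.ext hx
      rw [hz, P.op.map_zero, hx, add_zero] at e
      exact hx0 e.symm
    have hxd : x ∈ P.op.domain := by
      have := P.op.domain.smul_mem μ⁻¹ hd
      rwa [hx, smul_smul, inv_mul_cancel₀ hμ, one_smul] at this
    have hP : P.op ⟨x, hxd⟩ = (μ⁻¹ - 1) • x := by
      have hz : (⟨R x, hd⟩ : P.op.domain) = μ • ⟨x, hxd⟩ := Subtype.ext hx
      rw [hz, P.op.map_smul, hx] at e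
      have e' := congrArg (fun w => μ⁻¹ • w) e
      simp only [smul_add, smul_smul, inv_mul_cancel₀ hμ, one_smul] at e'
      rw [sub_smul, one_smul, ← e', add_sub_cancel_right]
    have hsm := P.op_symm ⟨x, hxd⟩ ⟨x, hxd⟩
    have hnn := P.nonneg ⟨x, hxd⟩
    rw [hP] at hsm hnn
    simp only [inner_smul_left, inner_smul_right] at hsm hnn
    have hxx : ⟪x, x⟫_ℂ ≠ 0 := inner_self_ne_zero.mpr hx0
    have hreal := mul_right_cancel₀ hxx hsm
    rw [Complex.conj_eq_iff_real] at hreal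
    obtain ⟨r, hr⟩ := hreal
    rw [hr, Complex.conj_ofReal, inner_self_eq_norm_sq_to_K] at hnn
    have hnn' : 0 ≤ r * ‖x‖ ^ 2 := by
      have : ((r : ℂ) * ((‖x‖ : ℂ)) ^ 2).re = r * ‖x‖ ^ 2 := by
        rw [← Complex.ofReal_pow, ← Complex.ofReal_mul, Complex.ofReal_re]
      rw [← this]; exact hnn
    have hr0 : 0 ≤ r := nonneg_of_mul_nonneg_left hnn' (by positivity)
    refine Submodule.mem_iSup_of_mem (⟨r, hr0⟩ : ℝ≥0) ⟨hxd, ?_⟩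
    rw [hP, hr]; rfl
  have hbot : (⨆ κ, P.eigenspace κ)ᗮ = ⊥ := by
    rw [eq_bot_iff]
    refine (Submodule.orthogonal_le (iSup_le hle)).trans ?_
    exact (ContinuousLinearMap.orthogonalComplement_iSup_eigenspaces_eq_bot hR hsymm).le
  rw [Submodule.topologicalClosure_eq_top_iff.mpr hbot]

/-- The unitary identification of `H` with `H_0`: a vector is sent to the family of its orthogonal
projections onto the eigenspaces of `P`. -/
def expand : H ≃ₗᵢ[ℂ] P.Hs 0 := P.isHilbertSum.linearIsometryEquiv.trans (P.sumEquiv 0).symm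

/-- The coefficients of `expand x` are the orthogonal projections of `x` onto the eigenspaces. -/
lemma inner_expand (x : H) (κ : ℝ≥0) (y : P.eigenspace κ) :
    ⟪y, (P.expand x : P.Expansion) κ⟫_ℂ = ⟪(y : H), x⟫_ℂ := by
  classical
  have h1 : P.toSum 0 (P.expand x) = P.isHilbertSum.linearIsometryEquiv x :=
    (P.sumEquiv 0).apply_symm_apply _
  have h2 : (P.expand x : P.Expansion) κ = P.isHilbertSum.linearIsometryEquiv x κ := by
    rw [← h1]
    change _ = P.Lam 0 (P.expand x : P.Expansion) κ
    rw [Lam_zero]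
  have h3 : P.isHilbertSum.linearIsometryEquiv (y : H)
      = lp.single (E := fun κ => P.eigenspace κ) 2 κ y := by
    rw [← LinearIsometryEquiv.apply_symm_apply P.isHilbertSum.linearIsometryEquiv
      (lp.single (E := fun κ => P.eigenspace κ) 2 κ y)]
    exact congrArg _ (P.isHilbertSum.linearIsometryEquiv_symm_apply_single y).symm
  rw [h2]
  refine (lp.inner_single_left (𝕜 := ℂ) κ y (P.isHilbertSum.linearIsometryEquiv x)).symm.trans ?_
  rw [← h3, LinearIsometryEquiv.inner_map_map]

/-- On its domain, the given operator `P` is the operator `P` on expansions. -/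
lemma expand_op (x : P.op.domain) :
    (P.expand (P.op x) : P.Expansion) = P.opP (P.expand (x : H) : P.Expansion) := by
  funext κ
  refine ext_inner_left ℂ fun y => ?_
  obtain ⟨y, hy, ey⟩ := y
  rw [inner_expand]
  change _ = ⟪_, (((κ : ℝ) : ℝ) : ℂ) • (P.expand (x : H) : P.Expansion) κ⟫_ℂ
  rw [inner_smul_right, inner_expand]
  have := P.op_symm ⟨y, hy⟩ x
  rw [ey, inner_smul_left, Complex.conj_ofReal] at this
  exact this.symm

/-- The domain of `P` is `H_1`. -/
lemma mem_domain_iff (x : H) : x ∈ P.op.domain ↔ (P.expand x : P.Expansion) ∈ P.Hs 1 := by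
  constructor
  · intro hx
    have h0 := P.expand_op ⟨x, hx⟩
    have h1 : P.expand (P.op ⟨x, hx⟩ + x) = P.Lam 1 (P.expand x : P.Expansion) := by
      rw [map_add, Submodule.coe_add, h0]
      funext κ
      change (((κ : ℝ) : ℝ) : ℂ) • (P.expand x : P.Expansion) κ + (P.expand x : P.Expansion) κ
        = (((1 + (κ : ℝ)) ^ (1 : ℝ) : ℝ) : ℂ) • (P.expand x : P.Expansion) κ
      rw [Real.rpow_one, Complex.ofReal_add, Complex.ofReal_one, add_smul, one_smul, add_comm]
    have h2 := P.Lam_mem (r := -1) (t := 1) (by norm_num) (P.expand (P.op ⟨x, hx⟩ + x)).2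
    rwa [h1, Lam_Lam, neg_add_cancel, Lam_zero] at h2
  · intro hx
    have hg : P.opP (P.expand x : P.Expansion) ∈ P.Hs 0 := by
      have := P.opSub_mem 0 (t := 0) (by norm_num) hx
      rwa [opSub_zero] at this
    obtain ⟨g, eg⟩ := P.expand.surjective ⟨_, hg⟩
    rw [← LinearPMap.isSelfAdjoint_def.mp P.selfAdjoint]
    refine LinearPMap.mem_adjoint_domain_of_exists _ ⟨g, fun y => ?_⟩
    rw [← P.expand.inner_map_map, ← P.expand.inner_map_map x]
    change ⟪P.toSum 0 (P.expand g), P.toSum 0 (P.expand (y : H))⟫_ℂ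
      = ⟪P.toSum 0 (P.expand x), P.toSum 0 (P.expand (P.op y))⟫_ℂ
    rw [lp.inner_eq_tsum, lp.inner_eq_tsum]
    refine tsum_congr fun κ => ?_
    change ⟪P.Lam 0 (P.expand g : P.Expansion) κ, P.Lam 0 (P.expand (y : H) : P.Expansion) κ⟫_ℂ
      = ⟪P.Lam 0 (P.expand x : P.Expansion) κ, P.Lam 0 (P.expand (P.op y) : P.Expansion) κ⟫_ℂ
    rw [Lam_zero, Lam_zero, Lam_zero, Lam_zero, expand_op, eg]
    change ⟪(((κ : ℝ) : ℝ) : ℂ) • (P.expand x : P.Expansion) κ, _⟫_ℂ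
      = ⟪_, (((κ : ℝ) : ℝ) : ℂ) • (P.expand (y : H) : P.Expansion) κ⟫_ℂ
    rw [inner_smul_left, inner_smul_right, Complex.conj_ofReal]

/-! ### The damped wave generator -/

variable {Y : Type*} [NormedAddCommGroup Y] [InnerProductSpace ℂ Y] [CompleteSpace Y]

/-- The control operator `Q^* : Y → H_{-γ}` of an observation operator `Q : H_γ → Y`: the adjoint of
`Q` with respect to the duality of `H_{-γ}` and `H_γ` that extends the inner product of `H`
(see `Qstar_mem` and `hasSum_Qstar`). It is `Λ ^ (2 γ)` applied to the adjoint of `Q` with respect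
to the inner product of `H_γ`. -/
def Qstar {γ : ℝ} (Q : P.Hs γ →L[ℂ] Y) : Y →ₗ[ℂ] P.Expansion :=
  P.Lam (2 * γ) ∘ₗ (P.Hs γ).subtype ∘ₗ (ContinuousLinearMap.adjoint Q : Y →ₗ[ℂ] P.Hs γ)

lemma Qstar_mem {γ : ℝ} (Q : P.Hs γ →L[ℂ] Y) (y : Y) : P.Qstar Q y ∈ P.Hs (-γ) :=
  P.Lam_mem (by linarith) (ContinuousLinearMap.adjoint Q y).2

lemma hasSum_Qstar {γ : ℝ} (Q : P.Hs γ →L[ℂ] Y) (y : Y) (w : P.Hs γ) :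
    HasSum (fun κ => ⟪P.Qstar Q y κ, (w : P.Expansion) κ⟫_ℂ) ⟪y, Q w⟫_ℂ := by
  rw [← ContinuousLinearMap.adjoint_inner_left]
  have h := lp.hasSum_inner (𝕜 := ℂ) (P.toSum γ (ContinuousLinearMap.adjoint Q y)) (P.toSum γ w)
  refine (congrArg (fun f => HasSum f _) (funext fun κ => ?_)).mpr h
  set z : P.Expansion := ((ContinuousLinearMap.adjoint Q y : P.Hs γ) : P.Expansion)
  change ⟪(((1 + (κ : ℝ)) ^ (2 * γ) : ℝ) : ℂ) • z κ, (w : P.Expansion) κ⟫_ℂ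
    = ⟪(((1 + (κ : ℝ)) ^ γ : ℝ) : ℂ) • z κ, (((1 + (κ : ℝ)) ^ γ : ℝ) : ℂ) • (w : P.Expansion) κ⟫_ℂ
  rw [inner_smul_left, inner_smul_left, inner_smul_right, Complex.conj_ofReal,
    Complex.conj_ofReal, two_mul, Real.rpow_add (by positivity), Complex.ofReal_mul, mul_assoc]

/-- `P u + Q^* Q v`, for `u` and `v` in `H_{1/2}`. -/
def force {γ : ℝ} (hγ : γ ≤ 1 / 2) (Q : P.Hs γ →L[ℂ] Y) :
    P.Hs (1 / 2) × P.Hs (1 / 2) →ₗ[ℂ] P.Expansion :=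
  (P.opP ∘ₗ (P.Hs (1 / 2)).subtype).coprod
    (P.Qstar Q ∘ₗ (Q : P.Hs γ →ₗ[ℂ] Y) ∘ₗ Submodule.inclusion fun _ => P.mem_of_le hγ)

/-- The state space `H_{1/2} × H`, with the norm `(‖u‖_{1/2} ^ 2 + ‖v‖ ^ 2) ^ (1 / 2)`. -/
abbrev State : Type _ := WithLp 2 (P.Hs (1 / 2) × P.Hs 0)

lemma Hs_half_le : P.Hs (1 / 2) ≤ P.Hs 0 := fun _ => P.mem_of_le (by norm_num)

/-- The inclusion of `H_{1/2} × H_{1/2}` into the state space. -/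
def toState : P.Hs (1 / 2) × P.Hs (1 / 2) →ₗ[ℂ] P.State :=
  (WithLp.linearEquiv 2 ℂ (P.Hs (1 / 2) × P.Hs 0)).symm.toLinearMap ∘ₗ
    LinearMap.prodMap LinearMap.id (Submodule.inclusion P.Hs_half_le)

lemma toState_injective : Function.Injective P.toState :=
  (WithLp.linearEquiv 2 ℂ (P.Hs (1 / 2) × P.Hs 0)).symm.injective.comp
    (Function.injective_id.prodMap (Submodule.inclusion_injective P.Hs_half_le))

/-- The domain `{(u, v) ∈ H_{1/2} × H_{1/2} | P u + Q^* Q v ∈ H}` of the generator. -/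
def domainD {γ : ℝ} (hγ : γ ≤ 1 / 2) (Q : P.Hs γ →L[ℂ] Y) :
    Submodule ℂ (P.Hs (1 / 2) × P.Hs (1 / 2)) :=
  (P.Hs 0).comap (P.force hγ Q)

/-- The formula `(u, v) ↦ (v, -(P u + Q^* Q v))` on the domain of the generator. -/
def generatorAux {γ : ℝ} (hγ : γ ≤ 1 / 2) (Q : P.Hs γ →L[ℂ] Y) : P.domainD hγ Q →ₗ[ℂ] P.State :=
  (WithLp.linearEquiv 2 ℂ (P.Hs (1 / 2) × P.Hs 0)).symm.toLinearMap ∘ₗ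
    LinearMap.prod (LinearMap.snd ℂ _ _ ∘ₗ (P.domainD hγ Q).subtype)
      (-(P.force hγ Q).restrict (p := P.domainD hγ Q) (q := P.Hs 0) fun _ h => h)

/-- The generator `A (u, v) = (v, -(P u + Q^* Q v))` of the damped wave equation, as an unbounded
operator on the state space, with domain `domainD` regarded as a subspace of the state space. -/
def generator {γ : ℝ} (hγ : γ ≤ 1 / 2) (Q : P.Hs γ →L[ℂ] Y) : P.State →ₗ.[ℂ] P.State where
  domain := (P.domainD hγ Q).map P.toState
  toFun := P.generatorAux hγ Q ∘ₗ
    ((P.domainD hγ Q).equivMapOfInjective P.toState P.toState_injective).symm.toLinearMap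

lemma toState_mem_domain {γ : ℝ} (hγ : γ ≤ 1 / 2) (Q : P.Hs γ →L[ℂ] Y) (U : P.domainD hγ Q) :
    P.toState U ∈ (P.generator hγ Q).domain := Submodule.mem_map_of_mem U.2

lemma generator_apply {γ : ℝ} (hγ : γ ≤ 1 / 2) (Q : P.Hs γ →L[ℂ] Y) (U : P.domainD hγ Q) :
    P.generator hγ Q ⟨P.toState U, P.toState_mem_domain hγ Q U⟩ = WithLp.toLp 2
      ((U : P.Hs (1 / 2) × P.Hs (1 / 2)).2, -(⟨P.force hγ Q U, U.2⟩ : P.Hs 0)) := by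
  have h : ((P.domainD hγ Q).equivMapOfInjective P.toState P.toState_injective).symm
      ⟨P.toState U, P.toState_mem_domain hγ Q U⟩ = U := by
    rw [LinearEquiv.symm_apply_eq]; rfl
  exact congrArg (P.generatorAux hγ Q) h

/-- The control estimate with parameter `μ` and functions `M`, `m`: there are `λ₀ ≥ 0`, `N > 0` and
`C` such that
`‖u‖ ≤ M(λ) ⟨λ⟩⁻¹ ‖(P - λ ^ 2) Λ ^ (μ - γ) u‖ + m(λ) ‖Q Λ ^ μ u‖ + C ‖Λ ^ (-N) u‖`
for all `λ ≥ λ₀` and `u ∈ H_{1 + μ - γ}`, where `⟨λ⟩ = (1 + λ ^ 2) ^ (1 / 2)`; the functions `M`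
and `m` are continuous on `[0, ∞)` and bounded below by a positive constant. -/
def ControlEstimate {γ : ℝ} (hγ : γ ≤ 1 / 2) (Q : P.Hs γ →L[ℂ] Y) (μ : ℝ) (hμ : 0 ≤ μ)
    (M m : ℝ → ℝ) : Prop :=
  ContinuousOn M (Set.Ici 0) ∧ ContinuousOn m (Set.Ici 0) ∧
  (∃ c > 0, ∀ t ≥ 0, c ≤ M t ∧ c ≤ m t) ∧
  ∃ (l₀ : ℝ) (_ : 0 ≤ l₀) (N : ℝ) (_ : 0 < N) (C : ℝ), ∀ l ≥ l₀, ∀ u : P.Hs (1 + μ - γ),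
    ‖(⟨u, P.mem_of_le (by linarith) u.2⟩ : P.Hs 0)‖ ≤
      M l * (√(1 + l ^ 2))⁻¹ *
        ‖(⟨P.opSub (l ^ 2) (P.Lam (μ - γ) u),
          P.opSub_mem (l ^ 2) (s := 1) (by linarith)
            (P.Lam_mem (by linarith) u.2)⟩ : P.Hs 0)‖ +
      m l * ‖Q ⟨P.Lam μ u, P.Lam_mem (by linarith) u.2⟩‖ +
      C * ‖(⟨P.Lam (-N) u, P.Lam_mem (by linarith) u.2⟩ : P.Hs 0)‖

end NonnegOperator
end DampedWave

end

noncomputable section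

namespace DampedWave

/-! ### The quadratic pencil in abstract Hilbert spaces. -/

section Abstract

variable {X Z Y : Type*} [NormedAddCommGroup X] [InnerProductSpace ℂ X] [CompleteSpace X]
  [NormedAddCommGroup Z] [InnerProductSpace ℂ Z] [CompleteSpace Z]
  [NormedAddCommGroup Y] [InnerProductSpace ℂ Y] [CompleteSpace Y]

/-! Write λ for `l`. Eliminating v = f - iλu from (A + iλ)(u, v) = (f, g) leaves (P - λ² - iλQ*Q)u =
iλf - g - Q*Qf. After multiplication by Λ⁻¹ the left side is a bounded operator T(λ) on H_{1/2}, the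
`pencil`, whose adjoint there is T(-λ). The real part of ⟨T(λ)u, u⟩ controls ‖u‖_{1/2} by ⟨λ⟩‖u‖_H
and the data; the imaginary part is λ‖Qu‖². Hence a resolvent bound of order K follows from ‖u‖_H ≤
(K/|λ|)‖g‖ for solutions of T(±λ)u = Λ⁻¹g: duality between λ and -λ handles data that lie only in
H_{1/2} (`norm_solution_le`, `resolventBound_of_pencil_bound`).

For the first claim, the control estimate is applied to Λ^{-μ}u, where T(λ)u = Λ⁻¹g. Here (P - λ²)u
= g + iλQ*Qu has H_{-γ} norm at most ‖g‖ + |λ|‖Q‖‖Qu‖. Frequencies far from λ² are controlled by P -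
λ² itself, so for large λ the remainder is absorbed, and passing from Λ^{-μ}u to u costs |λ|^{2μ}.
The result is ‖u‖ ≲ |λ|^{2μ}(M‖g‖/|λ| + (M + m)‖Qu‖). The damping identity |λ|‖Qu‖² ≤ ‖g‖‖u‖ then
removes the last term, at the price of squaring the coefficient (`pencil_bound_of_controlEstimate`).

For the second claim, w = Λ^μ u solves the pencil equation with data (P - λ²)w - iλQ*Qw in H_{-γ}.
Split at 1 + P = ⟨λ⟩², the low part lies in H and the high part becomes an element of H_{1/2} after
Λ⁻¹; both cost K⟨λ⟩^{2γ-1} (`norm_le_of_resolventBound`). Returning from Λ^μ u to u gains ⟨λ⟩^{-2μ},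
again up to a term in P - λ² (`one_le_high_add_low`). -/

/-- The lower bound makes the range closed, and injectivity of the adjoint makes it dense. -/
lemma bijective_of_bounded_below {T : X →L[ℂ] X} {C : ℝ} (hT : ∀ x, ‖x‖ ≤ C * ‖T x‖)
    (hT' : Function.Injective (ContinuousLinearMap.adjoint T)) : Function.Bijective T := by
  have hC : ∀ x, ‖x‖ ≤ (C.toNNReal : ℝ) * ‖T x‖ := fun x =>
    (hT x).trans (mul_le_mul_of_nonneg_right (Real.le_coe_toNNReal C) (norm_nonneg _))
  have hanti : AntilipschitzWith C.toNNReal T := AddMonoidHomClass.antilipschitz_of_bound T hC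
  refine ⟨hanti.injective, ?_⟩
  have hclosed : IsClosed (T.range : Set X) := by
    have := hanti.isClosed_range T.uniformContinuous
    rwa [← ContinuousLinearMap.coe_coe, ← LinearMap.coe_range] at this
  have hperp : T.rangeᗮ = ⊥ := by
    rw [ContinuousLinearMap.orthogonal_range]
    exact LinearMap.ker_eq_bot.mpr hT'
  have : CompleteSpace T.range := hclosed.completeSpace_coe
  have := Submodule.orthogonal_eq_bot_iff.mp hperp
  exact LinearMap.range_eq_top.mp this

/-- The quadratic pencil `1 - (1 + l ^ 2) ι† ι - i l q† q`. -/
def pencil (ι : X →L[ℂ] Z) (q : X →L[ℂ] Y) (l : ℝ) : X →L[ℂ] X :=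
  ContinuousLinearMap.id ℂ X - ((1 + l ^ 2 : ℝ) : ℂ) • (ContinuousLinearMap.adjoint ι ∘L ι)
    - (Complex.I * l) • (ContinuousLinearMap.adjoint q ∘L q)

variable (ι : X →L[ℂ] Z) (q : X →L[ℂ] Y) (l : ℝ)

lemma pencil_apply (u : X) : pencil ι q l u = u
    - ((1 + l ^ 2 : ℝ) : ℂ) • ContinuousLinearMap.adjoint ι (ι u)
    - (Complex.I * l) • ContinuousLinearMap.adjoint q (q u) := rfl

lemma inner_pencil_left (u w : X) : ⟪pencil ι q l u, w⟫_ℂ = ⟪u, w⟫_ℂ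
    - ((1 + l ^ 2 : ℝ) : ℂ) * ⟪ι u, ι w⟫_ℂ + (Complex.I * l) * ⟪q u, q w⟫_ℂ := by
  rw [pencil_apply, inner_sub_left, inner_sub_left, inner_smul_left, inner_smul_left,
    ContinuousLinearMap.adjoint_inner_left, ContinuousLinearMap.adjoint_inner_left]
  simp

lemma inner_pencil_right (u w : X) : ⟪u, pencil ι q l w⟫_ℂ = ⟪u, w⟫_ℂ
    - ((1 + l ^ 2 : ℝ) : ℂ) * ⟪ι u, ι w⟫_ℂ - (Complex.I * l) * ⟪q u, q w⟫_ℂ := by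
  rw [pencil_apply, inner_sub_right, inner_sub_right, inner_smul_right, inner_smul_right,
    ContinuousLinearMap.adjoint_inner_right, ContinuousLinearMap.adjoint_inner_right]

/-- Only the damping term is skew-adjoint, so taking adjoints amounts to changing the sign of `l`.
This is why a priori bounds are always required at both `l` and `-l`. -/
lemma adjoint_pencil : ContinuousLinearMap.adjoint (pencil ι q l) = pencil ι q (-l) := by
  symm
  rw [ContinuousLinearMap.eq_adjoint_iff]
  intro u w
  rw [inner_pencil_left, inner_pencil_right]
  push_cast
  ring

lemma inner_pencil_swap (u w : X) :
    ⟪pencil ι q l u, w⟫_ℂ = ⟪u, pencil ι q (-l) w⟫_ℂ := by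
  rw [← adjoint_pencil, ContinuousLinearMap.adjoint_inner_right]

lemma re_inner_pencil_self (u : X) :
    (⟪pencil ι q l u, u⟫_ℂ).re = ‖u‖ ^ 2 - (1 + l ^ 2) * ‖ι u‖ ^ 2 := by
  rw [inner_pencil_left, inner_self_eq_norm_sq_to_K, inner_self_eq_norm_sq_to_K,
    inner_self_eq_norm_sq_to_K]
  simp [← Complex.ofReal_pow]

lemma im_inner_pencil_self (u : X) :
    (⟪pencil ι q l u, u⟫_ℂ).im = l * ‖q u‖ ^ 2 := by
  rw [inner_pencil_left, inner_self_eq_norm_sq_to_K, inner_self_eq_norm_sq_to_K,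
    inner_self_eq_norm_sq_to_K]
  simp [← Complex.ofReal_pow]

lemma norm_sq_le_of_pencil_eq (u k : X) (h : pencil ι q l u = k) :
    ‖u‖ ^ 2 ≤ (1 + l ^ 2) * ‖ι u‖ ^ 2 + ‖k‖ * ‖u‖ := by
  have h1 := re_inner_pencil_self ι q l u
  rw [h] at h1
  have h2 : (⟪k, u⟫_ℂ).re ≤ ‖k‖ * ‖u‖ := re_inner_le_norm (𝕜 := ℂ) k u
  linarith

lemma norm_sq_le_of_pencil_eq_adjoint (u : X) (g : Z)
    (h : pencil ι q l u = ContinuousLinearMap.adjoint ι g) :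
    ‖u‖ ^ 2 ≤ (1 + l ^ 2) * ‖ι u‖ ^ 2 + ‖g‖ * ‖ι u‖ := by
  have h1 := re_inner_pencil_self ι q l u
  rw [h, ContinuousLinearMap.adjoint_inner_left] at h1
  have h2 : (⟪g, ι u⟫_ℂ).re ≤ ‖g‖ * ‖ι u‖ := re_inner_le_norm (𝕜 := ℂ) g (ι u)
  linarith

/-- The other two terms of the pencil are self-adjoint, so the imaginary part of the quadratic form
sees the damping alone. -/
lemma damping_le_of_pencil_eq_adjoint (u : X) (g : Z)
    (h : pencil ι q l u = ContinuousLinearMap.adjoint ι g) :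
    |l| * ‖q u‖ ^ 2 ≤ ‖g‖ * ‖ι u‖ := by
  have h1 := im_inner_pencil_self ι q l u
  rw [h, ContinuousLinearMap.adjoint_inner_left] at h1
  have h2 : ‖⟪g, ι u⟫_ℂ‖ ≤ ‖g‖ * ‖ι u‖ := norm_inner_le_norm g (ι u)
  have h3 := Complex.abs_im_le_norm ⟪g, ι u⟫_ℂ
  rw [h1, abs_mul, abs_of_nonneg (sq_nonneg ‖q u‖)] at h3
  exact h3.trans h2

/-- The pencil without its `ι`-term is coercive, hence onto. -/
lemma exists_coercive_solution (k : X) :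
    ∃ w : X, ‖w‖ ≤ ‖k‖ ∧ w - (Complex.I * l) • ContinuousLinearMap.adjoint q (q w) = k := by
  -- With ι = 0 the real part of the quadratic form is exactly ‖u‖².
  have hb : ∀ (r : ℝ) (u : X), ‖u‖ ≤ 1 * ‖pencil (0 : X →L[ℂ] X) q r u‖ := by
    intro r u
    have h := norm_sq_le_of_pencil_eq (0 : X →L[ℂ] X) q r u _ rfl
    rw [one_mul]
    simp only [_root_.zero_apply, norm_zero] at h
    by_cases hu : ‖u‖ = 0
    · rw [hu]; exact norm_nonneg _
    · have : 0 < ‖u‖ := lt_of_le_of_ne (norm_nonneg _) (Ne.symm hu)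
      nlinarith
  have hbij : Function.Bijective (pencil (0 : X →L[ℂ] X) q l) := by
    refine bijective_of_bounded_below (hb l) ?_
    rw [adjoint_pencil]
    exact (injective_iff_map_eq_zero _).mpr fun x hx => by
      have := hb (-l) x
      rw [hx, norm_zero, mul_zero] at this
      exact norm_le_zero_iff.mp this
  obtain ⟨w, hw⟩ := hbij.2 k
  refine ⟨w, ?_, ?_⟩
  · have := hb l w
    rwa [hw, one_mul] at this
  · rw [← hw, pencil_apply]
    simp

variable {ι q l}

/-- An a priori bound for the pencils at `l` and at `-l` with data in `Z` makes the pencil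
bijective. -/
lemma bijective_pencil {D : ℝ} (hι : ∀ x, ‖ι x‖ ≤ ‖x‖)
    (h : ∀ (u : X) (g : Z), pencil ι q l u = ContinuousLinearMap.adjoint ι g → ‖ι u‖ ≤ D * ‖g‖)
    (h' : ∀ (u : X) (g : Z), pencil ι q (-l) u = ContinuousLinearMap.adjoint ι g →
      ‖ι u‖ ≤ D * ‖g‖) : Function.Bijective (pencil ι q l) := by
  set D' := |D| * (1 + l ^ 2) + 1 with hD'
  have h1l : (0 : ℝ) < 1 + l ^ 2 := by positivity
  have key : ∀ u, ‖ι u‖ ≤ D' * ‖pencil ι q l u‖ := by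
    intro u
    obtain ⟨w, hw, ew⟩ := exists_coercive_solution q l (pencil ι q l u)
    -- The coercive solution `w` absorbs the part of the data not of the form ι†g; what remains
    -- comes from the omitted ι-term, hence is in the range of ι†.
    have e : pencil ι q l (u - w)
        = ContinuousLinearMap.adjoint ι (((1 + l ^ 2 : ℝ) : ℂ) • ι w) := by
      rw [map_sub, pencil_apply ι q l w, map_smul]
      conv_lhs => rw [← ew]
      abel
    have h1 := h _ _ e
    rw [norm_smul, Complex.norm_real, Real.norm_of_nonneg h1l.le, map_sub] at h1
    have h2 : ‖ι u‖ ≤ ‖ι u - ι w‖ + ‖ι w‖ := by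
      simpa using norm_add_le (ι u - ι w) (ι w)
    have h3 : ‖ι w‖ ≤ ‖pencil ι q l u‖ := (hι w).trans hw
    calc ‖ι u‖ ≤ D * ((1 + l ^ 2) * ‖ι w‖) + ‖ι w‖ := by linarith
      _ ≤ |D| * ((1 + l ^ 2) * ‖ι w‖) + ‖ι w‖ := by
        gcongr; exact le_abs_self D
      _ = D' * ‖ι w‖ := by rw [hD']; ring
      _ ≤ D' * ‖pencil ι q l u‖ := by gcongr
  refine bijective_of_bounded_below (C := (1 + l ^ 2) * D' + 1) (fun u => ?_) ?_
  · have h1 := norm_sq_le_of_pencil_eq ι q l u _ rfl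
    have h2 := key u
    have hD0 : 0 ≤ D' := by positivity
    set k := ‖pencil ι q l u‖
    have hk : 0 ≤ k := norm_nonneg _
    by_cases hu : ‖u‖ = 0
    · rw [hu]; positivity
    · have hu' : 0 < ‖u‖ := lt_of_le_of_ne (norm_nonneg _) (Ne.symm hu)
      -- One factor is bounded by `key`, the other by ‖u‖, so that a factor ‖u‖ can be cancelled at
      -- the end.
      have h3 : ‖ι u‖ ^ 2 ≤ D' * k * ‖u‖ := by
        rw [pow_two]
        exact mul_le_mul h2 (hι u) (norm_nonneg _) (by positivity)
      have h4 : ‖u‖ * ‖u‖ ≤ (((1 + l ^ 2) * D' + 1) * k) * ‖u‖ := by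
        nlinarith [mul_le_mul_of_nonneg_left h3 h1l.le]
      exact le_of_mul_le_mul_right h4 hu'
  · rw [adjoint_pencil]
    refine (injective_iff_map_eq_zero _).mpr fun x hx => ?_
    have h1 := h' x 0 (by rw [hx, map_zero])
    rw [norm_zero, mul_zero] at h1
    have h2 := norm_sq_le_of_pencil_eq ι q (-l) x 0 hx
    have h3 : ‖ι x‖ = 0 := le_antisymm h1 (norm_nonneg _)
    rw [h3, norm_zero] at h2
    have : ‖x‖ ^ 2 ≤ 0 := by linarith
    have : ‖x‖ = 0 := by nlinarith [norm_nonneg x]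
    exact norm_eq_zero.mp this

/-- Solution bounds for the first order system associated with the pencil. -/
lemma norm_solution_le {K : ℝ} (hK : 1 ≤ K) (hl : 1 ≤ |l|) (hι : ∀ x, ‖ι x‖ ≤ ‖x‖)
    (h : ∀ (u : X) (g : Z), pencil ι q l u = ContinuousLinearMap.adjoint ι g →
      ‖ι u‖ ≤ K / |l| * ‖g‖)
    (h' : ∀ (u : X) (g : Z), pencil ι q (-l) u = ContinuousLinearMap.adjoint ι g →
      ‖ι u‖ ≤ K / |l| * ‖g‖) (f u : X) (g : Z)
    (hu : pencil ι q l u = (Complex.I * l) • ContinuousLinearMap.adjoint ι (ι f)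
      - ContinuousLinearMap.adjoint ι g - ContinuousLinearMap.adjoint q (q f)) :
    ‖u‖ ≤ 9 * K * ‖f‖ + 2 * K * ‖g‖ ∧
      ‖ι (f - (Complex.I * l) • u)‖ ≤ 4 * K * ‖f‖ + K * ‖g‖ := by
  have hl0 : 0 < |l| := by linarith
  have hl2 : 1 + l ^ 2 ≤ 2 * |l| ^ 2 := by rw [sq_abs]; nlinarith [sq_abs l]
  have hKl : K / |l| * |l| = K := by field_simp
  have hKl' : K / |l| ≤ K := div_le_self (by linarith) hl
  -- data in `Z`, measured in `X`
  have hb : ∀ (r : ℝ), (1 + r ^ 2 = 1 + l ^ 2) → (∀ (u : X) (g : Z),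
      pencil ι q r u = ContinuousLinearMap.adjoint ι g → ‖ι u‖ ≤ K / |l| * ‖g‖) →
      ∀ (u : X) (g : Z), pencil ι q r u = ContinuousLinearMap.adjoint ι g →
        ‖u‖ ≤ 2 * K * ‖g‖ := by
    intro r hr hh u g e
    have h1 := norm_sq_le_of_pencil_eq_adjoint ι q r u g e
    have h2 := hh u g e
    have hg := norm_nonneg g
    have h3 : |l| * ‖ι u‖ ≤ K * ‖g‖ := by
      calc |l| * ‖ι u‖ ≤ |l| * (K / |l| * ‖g‖) := by gcongr
        _ = K * ‖g‖ := by rw [← mul_assoc, mul_comm |l|, hKl]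
    have h4 : ‖ι u‖ ≤ K * ‖g‖ := h2.trans (by gcongr)
    refine abs_le_of_sq_le_sq' ?_ (by positivity) |>.2
    rw [hr] at h1
    have h5 : (|l| * ‖ι u‖) ^ 2 ≤ (K * ‖g‖) ^ 2 := by gcongr
    have h6 : (1 + l ^ 2) * ‖ι u‖ ^ 2 ≤ 2 * (K * ‖g‖) ^ 2 := by
      calc (1 + l ^ 2) * ‖ι u‖ ^ 2 ≤ (2 * |l| ^ 2) * ‖ι u‖ ^ 2 := by gcongr
        _ = 2 * (|l| * ‖ι u‖) ^ 2 := by ring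
        _ ≤ _ := by gcongr
    have h7 : ‖g‖ * ‖ι u‖ ≤ (K * ‖g‖) ^ 2 := by
      calc ‖g‖ * ‖ι u‖ ≤ (K * ‖g‖) * (K * ‖g‖) := by
            gcongr; exact le_mul_of_one_le_left hg hK
        _ = _ := by ring
    nlinarith [sq_nonneg (K * ‖g‖)]
  have hbij := bijective_pencil hι h h'
  have hbij' : Function.Bijective (pencil ι q (-l)) :=
    bijective_pencil hι h' (by rwa [neg_neg])
  -- data in `X`, measured in `Z`
  have hc : ∀ u : X, ‖ι u‖ ≤ 2 * K * ‖pencil ι q l u‖ := by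
    intro u
    -- Duality: with T(-l)w = ι†ιu one has ‖ιu‖² = ⟨T(l)u, w⟩, and `hb` at `-l` bounds ‖w‖ by ‖ιu‖.
    obtain ⟨w, hw⟩ := hbij'.2 (ContinuousLinearMap.adjoint ι (ι u))
    have h1 := hb (-l) (by ring) h' w (ι u) hw
    have h2 := inner_pencil_swap ι q l u w
    rw [hw, ContinuousLinearMap.adjoint_inner_right, inner_self_eq_norm_sq_to_K] at h2
    have h3 := norm_inner_le_norm (𝕜 := ℂ) (pencil ι q l u) w
    rw [h2] at h3
    simp only [Complex.coe_algebraMap, norm_pow, Complex.norm_real, norm_norm] at h3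
    by_cases hz : ‖ι u‖ = 0
    · rw [hz]; positivity
    · have hz' : 0 < ‖ι u‖ := lt_of_le_of_ne (norm_nonneg _) (Ne.symm hz)
      have h4 : ‖pencil ι q l u‖ * ‖w‖ ≤ ‖pencil ι q l u‖ * (2 * K * ‖ι u‖) := by gcongr
      refine le_of_mul_le_mul_right ?_ hz'
      nlinarith
  have hd : ∀ u : X, ‖u‖ ≤ 4 * |l| * K * ‖pencil ι q l u‖ := by
    intro u
    have h1 := norm_sq_le_of_pencil_eq ι q l u _ rfl
    have h2 := hc u
    set k := ‖pencil ι q l u‖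
    have hk : 0 ≤ k := norm_nonneg _
    have h3 : (1 + l ^ 2) * ‖ι u‖ ^ 2 ≤ 8 * (|l| * K * k) ^ 2 := by
      calc (1 + l ^ 2) * ‖ι u‖ ^ 2 ≤ (2 * |l| ^ 2) * (2 * K * k) ^ 2 := by gcongr
        _ = _ := by ring
    have h4 : k ≤ |l| * K * k :=
      le_mul_of_one_le_left hk (one_le_mul_of_one_le_of_one_le hl hK)
    set a := |l| * K * k
    have ha : 0 ≤ a := hk.trans h4
    have h5 : ‖u‖ ^ 2 ≤ 8 * a ^ 2 + a * ‖u‖ := by nlinarith [norm_nonneg u]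
    have : ‖u‖ ≤ 4 * a := by
      by_contra! hcon
      nlinarith [norm_nonneg u]
    calc ‖u‖ ≤ 4 * a := this
      _ = _ := by ring
  obtain ⟨p, hp⟩ := hbij.2 (f - ContinuousLinearMap.adjoint ι (ι f))
  obtain ⟨s, hs⟩ := hbij.2 (ContinuousLinearMap.adjoint ι g)
  have hadj : ‖ContinuousLinearMap.adjoint ι (ι f)‖ ≤ ‖f‖ := by
    have h1 : ‖ContinuousLinearMap.adjoint ι‖ ≤ 1 := by
      rw [LinearIsometryEquiv.norm_map]
      exact ι.opNorm_le_bound zero_le_one fun x => by rw [one_mul]; exact hι x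
    calc _ ≤ 1 * ‖ι f‖ := ContinuousLinearMap.le_of_opNorm_le _ h1 _
      _ ≤ ‖f‖ := by rw [one_mul]; exact hι f
  have hpn : ‖pencil ι q l p‖ ≤ 2 * ‖f‖ := by
    rw [hp]
    have := norm_sub_le f (ContinuousLinearMap.adjoint ι (ι f))
    linarith
  -- Since (il)² = 1 - (1 + l²), multiplying the right-hand side by il turns it into T f - (f -
  -- ι†ιf) - il ι†g. The term q†q f is thus hidden in T f, and no factor ‖q‖ enters the bounds.
  have e1 : (Complex.I * l) • u = f - p - (Complex.I * l) • s := by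
    refine hbij.1 ?_
    rw [map_sub, map_sub, map_smul, map_smul, hu, hp, hs, pencil_apply, smul_sub, smul_sub,
      smul_smul]
    have : Complex.I * (l : ℂ) * (Complex.I * l) = 1 - ((1 + l ^ 2 : ℝ) : ℂ) := by
      push_cast
      linear_combination (l : ℂ) ^ 2 * Complex.I_sq
    rw [this, sub_smul, one_smul]
    abel
  have e2 : f - (Complex.I * l) • u = p + (Complex.I * l) • s := by rw [e1]; abel
  have hnorm : ‖Complex.I * (l : ℂ)‖ = |l| := by simp
  constructor
  · have h1 : |l| * ‖u‖ ≤ ‖f‖ + ‖p‖ + |l| * ‖s‖ := by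
      rw [← hnorm, ← norm_smul, ← norm_smul, e1]
      exact (norm_sub_le _ _).trans (add_le_add_left (norm_sub_le _ _) _)
    have h2 : ‖p‖ ≤ 8 * |l| * K * ‖f‖ := by
      calc ‖p‖ ≤ 4 * |l| * K * ‖pencil ι q l p‖ := hd p
        _ ≤ 4 * |l| * K * (2 * ‖f‖) := by gcongr
        _ = _ := by ring
    have h3 := hb l rfl h s g hs
    have h4 : ‖f‖ ≤ |l| * (K * ‖f‖) := by
      rw [← mul_assoc]
      exact le_mul_of_one_le_left (norm_nonneg _) (one_le_mul_of_one_le_of_one_le hl hK)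
    have h5 := mul_le_mul_of_nonneg_left h3 hl0.le
    refine le_of_mul_le_mul_left ?_ hl0
    linarith
  · rw [e2, map_add, map_smul]
    have h1 := norm_add_le (ι p) ((Complex.I * l) • ι s)
    rw [norm_smul, hnorm] at h1
    have h2 : ‖ι p‖ ≤ 4 * K * ‖f‖ := by
      calc ‖ι p‖ ≤ 2 * K * ‖pencil ι q l p‖ := hc p
        _ ≤ 2 * K * (2 * ‖f‖) := by gcongr
        _ = _ := by ring
    have h3 : |l| * ‖ι s‖ ≤ K * ‖g‖ := by
      calc |l| * ‖ι s‖ ≤ |l| * (K / |l| * ‖g‖) := by gcongr; exact h s g hs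
        _ = K * ‖g‖ := by rw [← mul_assoc, mul_comm |l|, hKl]
    linarith

end Abstract

end DampedWave

end

noncomputable section

namespace DampedWave
namespace NonnegOperator

variable {H : Type*} [NormedAddCommGroup H] [InnerProductSpace ℂ H] [CompleteSpace H]
variable (P : NonnegOperator H)

/-! ### Weighted norms and inclusions of the spaces H_s. -/

lemma fn_apply (f : ℝ → ℝ) (u : P.Expansion) (κ : ℝ≥0) :
    P.fn f u κ = ((f κ : ℝ) : ℂ) • u κ := rfl

lemma norm_fn_apply (f : ℝ → ℝ) (u : P.Expansion) (κ : ℝ≥0) :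
    ‖P.fn f u κ‖ = |f κ| * ‖u κ‖ := by
  rw [fn_apply, norm_smul, Complex.norm_real, Real.norm_eq_abs]

lemma norm_Lam_apply (s : ℝ) (u : P.Expansion) (κ : ℝ≥0) :
    ‖P.Lam s u κ‖ = (1 + (κ : ℝ)) ^ s * ‖u κ‖ := by
  rw [Lam, norm_fn_apply, abs_of_pos (weight_pos κ s)]

lemma norm_opSub_apply (c : ℝ) (u : P.Expansion) (κ : ℝ≥0) :
    ‖P.opSub c u κ‖ = |(κ : ℝ) - c| * ‖u κ‖ := by
  rw [opSub, norm_fn_apply]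

lemma Lam_opSub (s c : ℝ) (u : P.Expansion) :
    P.Lam s (P.opSub c u) = P.opSub c (P.Lam s u) := by
  funext κ
  exact smul_comm (((1 + (κ : ℝ)) ^ s : ℝ) : ℂ) (((κ : ℝ) - c : ℝ) : ℂ) (u κ)

lemma Lam_one (u : P.Expansion) : P.Lam 1 u = P.opP u + u := by
  funext κ
  change (((1 + (κ : ℝ)) ^ (1 : ℝ) : ℝ) : ℂ) • u κ = (((κ : ℝ) : ℝ) : ℂ) • u κ + u κ
  rw [Real.rpow_one, Complex.ofReal_add, Complex.ofReal_one, add_smul, one_smul, add_comm]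

lemma opSub_eq (c : ℝ) (u : P.Expansion) : P.opSub c u = P.opP u - (c : ℂ) • u := by
  funext κ
  change (((κ : ℝ) - c : ℝ) : ℂ) • u κ = (((κ : ℝ) : ℝ) : ℂ) • u κ - (c : ℂ) • u κ
  rw [Complex.ofReal_sub, sub_smul]

lemma Lam_one_eq (c : ℝ) (u : P.Expansion) :
    P.Lam 1 u = P.opSub c u + ((1 + c : ℝ) : ℂ) • u := by
  rw [Lam_one, opSub_eq, Complex.ofReal_add, Complex.ofReal_one, add_smul, one_smul]
  abel

lemma Lam_injective (s : ℝ) : Function.Injective (P.Lam s) := by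
  intro u v h
  have h2 := congrArg (P.Lam (-s)) h
  rwa [Lam_Lam, Lam_Lam, neg_add_cancel, Lam_zero, Lam_zero] at h2

lemma Lam_mem_iff {r s : ℝ} {u : P.Expansion} : P.Lam r u ∈ P.Hs s ↔ u ∈ P.Hs (s + r) := by
  constructor
  · intro h
    have := P.Lam_mem (r := -r) (t := s + r) (by linarith) h
    rwa [Lam_Lam, neg_add_cancel, Lam_zero] at this
  · intro h
    exact P.Lam_mem le_rfl h

lemma hasSum_norm_sq {s : ℝ} {u : P.Expansion} (hu : u ∈ P.Hs s) :
    HasSum (fun κ : ℝ≥0 => ((1 + (κ : ℝ)) ^ s * ‖u κ‖) ^ 2) (‖(⟨u, hu⟩ : P.Hs s)‖ ^ 2) := by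
  have h := lp.hasSum_norm (p := 2) (by norm_num) (P.toSum s ⟨u, hu⟩)
  rw [norm_def]
  have e : (2 : ℝ≥0∞).toReal = ((2 : ℕ) : ℝ) := by norm_num
  simp only [e, Real.rpow_natCast] at h
  refine (congrArg (fun f => HasSum f _) (funext fun κ => ?_)).mpr h
  change _ = ‖P.Lam s u κ‖ ^ 2
  rw [norm_Lam_apply]

lemma norm_le_of_apply_le {s t A : ℝ} (hA : 0 ≤ A) {u v : P.Expansion}
    (hu : u ∈ P.Hs s) (hv : v ∈ P.Hs t)
    (h : ∀ κ : ℝ≥0, (1 + (κ : ℝ)) ^ s * ‖u κ‖ ≤ A * ((1 + (κ : ℝ)) ^ t * ‖v κ‖)) :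
    ‖(⟨u, hu⟩ : P.Hs s)‖ ≤ A * ‖(⟨v, hv⟩ : P.Hs t)‖ := by
  refine abs_le_of_sq_le_sq' ?_ (by positivity) |>.2
  rw [mul_pow]
  refine hasSum_le (fun κ => ?_) (P.hasSum_norm_sq hu) ((P.hasSum_norm_sq hv).mul_left (A ^ 2))
  rw [← mul_pow]
  have := weight_pos κ s
  exact pow_le_pow_left₀ (by positivity) (h κ) 2

/-- This transfers a scalar inequality on the spectrum to norms. The factor 2 is a crude form of the
√2 from (a + b)² ≤ 2(a² + b²). -/
lemma norm_le_add_of_apply_le {s t r A B : ℝ} (hA : 0 ≤ A) (hB : 0 ≤ B) {u v w : P.Expansion}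
    (hu : u ∈ P.Hs s) (hv : v ∈ P.Hs t) (hw : w ∈ P.Hs r)
    (h : ∀ κ : ℝ≥0, (1 + (κ : ℝ)) ^ s * ‖u κ‖ ≤
      A * ((1 + (κ : ℝ)) ^ t * ‖v κ‖) + B * ((1 + (κ : ℝ)) ^ r * ‖w κ‖)) :
    ‖(⟨u, hu⟩ : P.Hs s)‖ ≤ 2 * (A * ‖(⟨v, hv⟩ : P.Hs t)‖ + B * ‖(⟨w, hw⟩ : P.Hs r)‖) := by
  set a := ‖(⟨v, hv⟩ : P.Hs t)‖
  set b := ‖(⟨w, hw⟩ : P.Hs r)‖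
  refine abs_le_of_sq_le_sq' ?_ (by positivity) |>.2
  have h1 : ‖(⟨u, hu⟩ : P.Hs s)‖ ^ 2 ≤ 2 * A ^ 2 * a ^ 2 + 2 * B ^ 2 * b ^ 2 := by
    refine hasSum_le (fun κ => ?_) (P.hasSum_norm_sq hu)
      (((P.hasSum_norm_sq hv).mul_left (2 * A ^ 2)).add
        ((P.hasSum_norm_sq hw).mul_left (2 * B ^ 2)))
    have h0 := weight_pos κ s
    have h2 := pow_le_pow_left₀ (by positivity) (h κ) 2
    have h3 := add_sq_le (a := A * ((1 + (κ : ℝ)) ^ t * ‖v κ‖))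
      (b := B * ((1 + (κ : ℝ)) ^ r * ‖w κ‖))
    nlinarith
  have : 0 ≤ (A * a) * (B * b) := by positivity
  nlinarith [sq_nonneg (A * a), sq_nonneg (B * b)]

lemma norm_congr {s t : ℝ} {u v : P.Expansion} (hu : u ∈ P.Hs s) (hv : v ∈ P.Hs t)
    (h : P.Lam s u = P.Lam t v) : ‖(⟨u, hu⟩ : P.Hs s)‖ = ‖(⟨v, hv⟩ : P.Hs t)‖ := by
  rw [norm_def, norm_def]
  congr 1
  exact Subtype.ext h

/-- The inclusion of `H_s` into `H_t`, for `t ≤ s`, as a linear map. -/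
def inclₗ {s t : ℝ} (h : t ≤ s) : P.Hs s →ₗ[ℂ] P.Hs t :=
  Submodule.inclusion fun _ => P.mem_of_le h

lemma coe_inclₗ {s t : ℝ} (h : t ≤ s) (u : P.Hs s) : (P.inclₗ h u : P.Expansion) = u :=
  Submodule.coe_inclusion (fun _ => P.mem_of_le h) u

lemma norm_inclₗ_le {s t : ℝ} (h : t ≤ s) (u : P.Hs s) : ‖P.inclₗ h u‖ ≤ 1 * ‖u‖ := by
  have e : P.inclₗ h u = ⟨u, P.mem_of_le h u.2⟩ := Subtype.ext (P.coe_inclₗ h u)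
  rw [e]
  refine P.norm_le_of_apply_le zero_le_one (P.mem_of_le h u.2) u.2 fun κ => ?_
  rw [one_mul]
  refine mul_le_mul_of_nonneg_right ?_ (norm_nonneg _)
  exact Real.rpow_le_rpow_of_exponent_le (by simp) h

/-- The inclusion of `H_s` into `H_t`, for `t ≤ s`. -/
def incl {s t : ℝ} (h : t ≤ s) : P.Hs s →L[ℂ] P.Hs t :=
  (P.inclₗ h).mkContinuous 1 (P.norm_inclₗ_le h)

lemma coe_incl {s t : ℝ} (h : t ≤ s) (u : P.Hs s) :
    (P.incl h u : P.Expansion) = u := by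
  rw [incl, LinearMap.mkContinuous_apply, coe_inclₗ]

lemma norm_incl_le {s t : ℝ} (h : t ≤ s) (u : P.Hs s) : ‖P.incl h u‖ ≤ ‖u‖ := by
  rw [incl, LinearMap.mkContinuous_apply, ← one_mul ‖u‖]
  exact P.norm_inclₗ_le h u

lemma inner_def (s : ℝ) (u v : P.Hs s) : ⟪u, v⟫_ℂ =
    ∑' κ, ⟪P.Lam s u κ, P.Lam s v κ⟫_ℂ := by
  change ⟪P.toSum s u, P.toSum s v⟫_ℂ = _
  rw [lp.inner_eq_tsum]
  rfl

/-- The inner products of H_t and H_s carry the weights (1 + κ)^{2t} and (1 + κ)^{2s}, and the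
adjoint makes up for their quotient. For the inclusion of H_{1/2} into H it is Λ⁻¹. -/
lemma coe_adjoint_incl {s t : ℝ} (h : t ≤ s) (x : P.Hs t) :
    (ContinuousLinearMap.adjoint (P.incl h) x : P.Expansion) = P.Lam (2 * (t - s)) x := by
  have hm : P.Lam (2 * (t - s)) x ∈ P.Hs s := P.Lam_mem (by linarith) x.2
  suffices hx : ContinuousLinearMap.adjoint (P.incl h) x = ⟨_, hm⟩ from congrArg Subtype.val hx
  refine ext_inner_right ℂ fun y => ?_
  rw [ContinuousLinearMap.adjoint_inner_left, inner_def, inner_def]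
  refine tsum_congr fun κ => ?_
  rw [Lam_Lam]
  have e : ∀ (a b : ℝ) (v w : P.Expansion), ⟪P.Lam a v κ, P.Lam b w κ⟫_ℂ
      = (((1 + (κ : ℝ)) ^ (a + b) : ℝ) : ℂ) * ⟪v κ, w κ⟫_ℂ := by
    intro a b v w
    rw [Lam, Lam, fn_apply, fn_apply, inner_smul_left, inner_smul_right, Complex.conj_ofReal,
      Real.rpow_add (by positivity), Complex.ofReal_mul, mul_assoc]
  rw [e, e, coe_incl]
  rw [show t + t = s + 2 * (t - s) + s by ring]

/-! ### The pencil on H_{1/2} and its relation to P and Q*Q. -/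

variable {Y : Type*} [NormedAddCommGroup Y] [InnerProductSpace ℂ Y] [CompleteSpace Y]
variable {γ : ℝ} (hγ : γ ≤ 1 / 2) (Q : P.Hs γ →L[ℂ] Y)

lemma zero_le_half : (0 : ℝ) ≤ 1 / 2 := by norm_num

/-- The inclusion of `H_{1/2}` into `H`. -/
abbrev ιE : P.Hs (1 / 2) →L[ℂ] P.Hs 0 := P.incl zero_le_half

/-- The restriction of `Q` to `H_{1/2}`. -/
abbrev qE : P.Hs (1 / 2) →L[ℂ] Y := Q ∘L P.incl hγ

/-- The pencil `Λ⁻¹ (P - l ^ 2 - i l Q^* Q)` on `H_{1/2}`. -/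
abbrev pencilE (l : ℝ) : P.Hs (1 / 2) →L[ℂ] P.Hs (1 / 2) := pencil P.ιE (P.qE hγ Q) l

lemma Lam_one_adjoint_ιE (g : P.Hs 0) :
    P.Lam 1 (ContinuousLinearMap.adjoint P.ιE g : P.Hs (1 / 2)) = (g : P.Expansion) := by
  rw [coe_adjoint_incl, Lam_Lam]
  norm_num [Lam_zero]

lemma Lam_one_adjoint_qE (y : Y) :
    P.Lam 1 (ContinuousLinearMap.adjoint (P.qE hγ Q) y : P.Hs (1 / 2)) = P.Qstar Q y := by
  rw [ContinuousLinearMap.adjoint_comp, ContinuousLinearMap.comp_apply, coe_adjoint_incl, Lam_Lam]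
  change _ = P.Lam (2 * γ) _
  congr 2
  ring

lemma force_apply (u v : P.Hs (1 / 2)) :
    P.force hγ Q (u, v) = P.opP u + P.Qstar Q (P.qE hγ Q v) := rfl

/-- The second equation is Λ⁻¹ applied to the first, because Pu = Λu - u, and Λ sends ι†g to g and
q†y to Q*y. It takes place inside H_{1/2}, where the abstract results apply. -/
lemma force_eq_iff (u v : P.Hs (1 / 2)) (g : P.Hs 0) : P.force hγ Q (u, v) = g ↔
    u - ContinuousLinearMap.adjoint P.ιE (P.ιE u)
      + ContinuousLinearMap.adjoint (P.qE hγ Q) (P.qE hγ Q v)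
      = ContinuousLinearMap.adjoint P.ιE g := by
  rw [← Subtype.val_injective.eq_iff (a := u - _ + _),
    ← (P.Lam_injective 1).eq_iff (b := (ContinuousLinearMap.adjoint P.ιE g : P.Hs (1 / 2)).1),
    Lam_one_adjoint_ιE]
  have : P.Lam 1 ((u - ContinuousLinearMap.adjoint P.ιE (P.ιE u)
      + ContinuousLinearMap.adjoint (P.qE hγ Q) (P.qE hγ Q v) : P.Hs (1 / 2)) : P.Expansion)
      = P.force hγ Q (u, v) := by
    rw [Submodule.coe_add, Submodule.coe_sub, map_add, map_sub, Lam_one_adjoint_ιE,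
      Lam_one_adjoint_qE, Lam_one, coe_incl, force_apply]
    abel
  rw [this]

lemma Lam_one_pencilE (l : ℝ) (u : P.Hs (1 / 2)) : P.Lam 1 (P.pencilE hγ Q l u) =
    P.opSub (l ^ 2) u - (Complex.I * l) • P.Qstar Q (P.qE hγ Q u) := by
  rw [pencil_apply, Submodule.coe_sub, Submodule.coe_sub, Submodule.coe_smul, Submodule.coe_smul,
    map_sub, map_sub, map_smul, map_smul, Lam_one_adjoint_ιE, Lam_one_adjoint_qE, coe_incl,
    P.Lam_one_eq (l ^ 2)]
  abel

lemma norm_Qstar_le (y : Y) :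
    ‖(⟨P.Qstar Q y, P.Qstar_mem Q y⟩ : P.Hs (-γ))‖ ≤ ‖Q‖ * ‖y‖ := by
  have h : ‖(⟨P.Qstar Q y, P.Qstar_mem Q y⟩ : P.Hs (-γ))‖ = ‖ContinuousLinearMap.adjoint Q y‖ := by
    refine P.norm_congr _ (ContinuousLinearMap.adjoint Q y).2 ?_
    change P.Lam (-γ) (P.Lam (2 * γ) _) = _
    rw [Lam_Lam]
    congr 2
    ring
  rw [h]
  have := (ContinuousLinearMap.adjoint Q).le_opNorm y
  rwa [LinearIsometryEquiv.norm_map] at this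

/-! ### The generator and the pencil -/

lemma exists_of_mem_domain {x : P.State} (hx : x ∈ (P.generator hγ Q).domain) :
    ∃ (u v : P.Hs (1 / 2)) (g : P.Hs 0), x = P.toState (u, v) ∧ P.force hγ Q (u, v) = g ∧
      P.generator hγ Q ⟨x, hx⟩ = WithLp.toLp 2 (v, -g) := by
  obtain ⟨⟨u, v⟩, hU, rfl⟩ := hx
  exact ⟨u, v, ⟨_, hU⟩, rfl, rfl, P.generator_apply hγ Q ⟨(u, v), hU⟩⟩

lemma toState_mem {u v : P.Hs (1 / 2)} {g : P.Hs 0} (h : P.force hγ Q (u, v) = g) :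
    ∃ hx : P.toState (u, v) ∈ (P.generator hγ Q).domain,
      P.generator hγ Q ⟨P.toState (u, v), hx⟩ = WithLp.toLp 2 (v, -g) := by
  have hU : (u, v) ∈ P.domainD hγ Q := by
    change P.force hγ Q (u, v) ∈ P.Hs 0
    rw [h]; exact g.2
  refine ⟨Submodule.mem_map_of_mem hU, ?_⟩
  have := P.generator_apply hγ Q ⟨(u, v), hU⟩
  rw [this]
  congr 3
  exact Subtype.ext h

lemma toState_apply (u v : P.Hs (1 / 2)) :
    P.toState (u, v) = WithLp.toLp 2 (u, P.ιE v) := rfl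

end NonnegOperator
end DampedWave

end

noncomputable section

namespace DampedWave

/-! ### Reduction of the first order system to the pencil. -/

section Abstract

variable {X Z Y : Type*} [NormedAddCommGroup X] [InnerProductSpace ℂ X] [CompleteSpace X]
  [NormedAddCommGroup Z] [InnerProductSpace ℂ Z] [CompleteSpace Z]
  [NormedAddCommGroup Y] [InnerProductSpace ℂ Y] [CompleteSpace Y]
variable (ι : X →L[ℂ] Z) (q : X →L[ℂ] Y) (l : ℝ)

/-- The reduction of the first order system to the pencil. -/
lemma pencil_eq_iff {u v f : X} {g g' : Z} (hv : v + (Complex.I * l) • u = f)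
    (hg : -g' + (Complex.I * l) • ι v = g) :
    u - ContinuousLinearMap.adjoint ι (ι u) + ContinuousLinearMap.adjoint q (q v)
        = ContinuousLinearMap.adjoint ι g' ↔
      pencil ι q l u = (Complex.I * l) • ContinuousLinearMap.adjoint ι (ι f)
        - ContinuousLinearMap.adjoint ι g - ContinuousLinearMap.adjoint q (q f) := by
  rw [← sub_eq_zero, ← sub_eq_zero (a := pencil ι q l u)]
  have hI : ((1 + l ^ 2 : ℝ) : ℂ) = 1 - (Complex.I * l) * (Complex.I * l) := by
    push_cast
    linear_combination (l : ℂ) ^ 2 * Complex.I_sq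
  subst hv hg
  rw [pencil_apply, hI]
  simp only [map_add, map_neg, map_smul, smul_add, sub_smul, one_smul, smul_smul]
  refine Eq.congr ?_ rfl
  abel

/-- The velocity component v = f - ilu of the system with g = 0 itself solves a pencil equation, now
with data in X. This lets a resolvent bound on v serve for such data. -/
lemma pencil_sub_smul {u f : X}
    (h : pencil ι q l u = (Complex.I * l) • ContinuousLinearMap.adjoint ι (ι f)
        - ContinuousLinearMap.adjoint q (q f)) :
    pencil ι q l (f - (Complex.I * l) • u) = f - ContinuousLinearMap.adjoint ι (ι f) := by
  have hI : ((1 + l ^ 2 : ℝ) : ℂ) = 1 - (Complex.I * l) * (Complex.I * l) := by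
    push_cast
    linear_combination (l : ℂ) ^ 2 * Complex.I_sq
  rw [map_sub, map_smul, h, pencil_apply, hI]
  simp only [smul_sub, sub_smul, one_smul, smul_smul]
  abel

end Abstract

/-! ### Scalar inequalities -/

lemma inv_sqrt_eq_rpow {L : ℝ} (hL : 0 ≤ L) : (√L)⁻¹ = L ^ (-(1 / 2) : ℝ) := by
  rw [Real.sqrt_eq_rpow, Real.rpow_neg hL]

/-- Here ρ = 1 + κ and L = 1 + l², so that ρ - L = κ - l². For ρ ≥ L/4 the left side is small once L
is large; for ρ < L/4 the last term exceeds 1, because |ρ - L| ≥ 3L/4 and ρ^{μ-γ} ≥ L^{-1/2}. It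
serves to absorb the remainder Λ^{-N}u. -/
lemma rpow_neg_le_add {N ε μ γ : ℝ} (hN : 0 < N) (hε : 0 < ε) (hμ : 0 ≤ μ) (hγ : γ ≤ 1 / 2) :
    ∃ L₀ : ℝ, 1 ≤ L₀ ∧ ∀ L ≥ L₀, ∀ ρ : ℝ, 1 ≤ ρ →
      ρ ^ (-N) ≤ ε + 2 * (√L)⁻¹ * (|ρ - L| * ρ ^ (μ - γ)) := by
  have ht : Filter.Tendsto (fun L : ℝ => (L / 4) ^ (-N)) Filter.atTop (nhds 0) :=
    (tendsto_rpow_neg_atTop hN).comp (Filter.tendsto_id.atTop_div_const (by norm_num))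
  obtain ⟨L₁, h₁⟩ := Filter.eventually_atTop.mp (ht.eventually (ge_mem_nhds hε))
  refine ⟨max L₁ 1, le_max_right _ _, fun L hL ρ hρ => ?_⟩
  have hL1 : 1 ≤ L := (le_max_right _ _).trans hL
  have hL0 : 0 < L := by linarith
  have hρ0 : 0 < ρ := by linarith
  rcases le_or_gt (L / 4) ρ with h | h
  · have h2 : ρ ^ (-N) ≤ (L / 4) ^ (-N) :=
      Real.rpow_le_rpow_of_nonpos (by positivity) h (by linarith)
    have h3 := h₁ L ((le_max_left _ _).trans hL)
    have : 0 ≤ 2 * (√L)⁻¹ * (|ρ - L| * ρ ^ (μ - γ)) := by positivity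
    linarith
  · have h2 : ρ ^ (-N) ≤ 1 := Real.rpow_le_one_of_one_le_of_nonpos hρ (by linarith)
    have h3 : 3 / 4 * L ≤ |ρ - L| := by
      rw [abs_sub_comm]
      exact le_trans (by linarith) (le_abs_self _)
    have h4 : (√L)⁻¹ ≤ ρ ^ (μ - γ) := by
      rw [inv_sqrt_eq_rpow hL0.le]
      calc L ^ (-(1 / 2) : ℝ) ≤ ρ ^ (-(1 / 2) : ℝ) :=
            Real.rpow_le_rpow_of_nonpos hρ0 (by linarith) (by norm_num)
        _ ≤ _ := Real.rpow_le_rpow_of_exponent_le hρ (by linarith)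
    have h5 : 2 * (√L)⁻¹ * (3 / 4 * L * (√L)⁻¹) ≤ 2 * (√L)⁻¹ * (|ρ - L| * ρ ^ (μ - γ)) := by
      gcongr
    have h6 : 2 * (√L)⁻¹ * (3 / 4 * L * (√L)⁻¹) = 3 / 2 := by
      have hs : √L ≠ 0 := (Real.sqrt_pos.mpr hL0).ne'
      field_simp
      rw [Real.sq_sqrt hL0.le]; ring
    linarith

/-- Used to return from Λ^{-μ}u to u: for ρ ≤ 4L the weight ρ^{-μ} loses at most (4L)^{-μ}, and for
ρ > 4L the factor |ρ - L| is comparable to ρ. -/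
lemma one_le_low_add_high {L ρ μ γ : ℝ} (hL : 1 ≤ L) (hρ : 1 ≤ ρ) (hμ : 0 ≤ μ)
    (hγ : γ ≤ 1 / 2) :
    1 ≤ 4 ^ μ * L ^ μ * ρ ^ (-μ) + 2 * (√L)⁻¹ * (|ρ - L| * ρ ^ (-γ)) := by
  have hL0 : 0 < L := by linarith
  have hρ0 : 0 < ρ := by linarith
  rcases le_or_gt ρ (4 * L) with h | h
  · have h2 : ρ ^ μ ≤ 4 ^ μ * L ^ μ := by
      rw [← Real.mul_rpow (by norm_num) hL0.le]
      exact Real.rpow_le_rpow hρ0.le h hμ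
    have h3 : 1 ≤ 4 ^ μ * L ^ μ * ρ ^ (-μ) := by
      calc 1 = ρ ^ μ * ρ ^ (-μ) := by rw [← Real.rpow_add hρ0, add_neg_cancel, Real.rpow_zero]
        _ ≤ _ := by gcongr
    have : 0 ≤ 2 * (√L)⁻¹ * (|ρ - L| * ρ ^ (-γ)) := by positivity
    linarith
  · have h3 : 3 / 4 * ρ ≤ |ρ - L| := le_trans (by linarith) (le_abs_self _)
    have h4 : (√ρ)⁻¹ ≤ ρ ^ (-γ) := by
      rw [inv_sqrt_eq_rpow hρ0.le]
      exact Real.rpow_le_rpow_of_exponent_le hρ (by linarith)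
    have h4' : (√ρ)⁻¹ ≤ (√L)⁻¹ :=
      inv_anti₀ (Real.sqrt_pos.mpr hL0) (Real.sqrt_le_sqrt (by linarith))
    have h5 : 2 * (√ρ)⁻¹ * (3 / 4 * ρ * (√ρ)⁻¹) ≤ 2 * (√L)⁻¹ * (|ρ - L| * ρ ^ (-γ)) := by
      gcongr
    have h6 : 2 * (√ρ)⁻¹ * (3 / 4 * ρ * (√ρ)⁻¹) = 3 / 2 := by
      have hs : √ρ ≠ 0 := (Real.sqrt_pos.mpr hρ0).ne'
      field_simp
      rw [Real.sq_sqrt hρ0.le]; ring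
    have : 0 ≤ 4 ^ μ * L ^ μ * ρ ^ (-μ) := by positivity
    linarith

/-- Used to return from Λ^μ u to u with a gain L^{-μ}: the weight ρ^μ provides it for ρ ≥ L/4, and
below that |ρ - L| is comparable to L. -/
lemma one_le_high_add_low {L ρ μ γ : ℝ} (hL : 1 ≤ L) (hρ : 1 ≤ ρ) (hμ : 0 ≤ μ)
    (hμγ : μ ≤ 1 / 2 + γ) :
    1 ≤ 4 ^ μ * L ^ (-μ) * ρ ^ μ + 2 * (L ^ (γ - μ) * (√L)⁻¹) * (|ρ - L| * ρ ^ (μ - γ)) := by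
  have hL0 : 0 < L := by linarith
  have hρ0 : 0 < ρ := by linarith
  rcases le_or_gt (L / 4) ρ with h | h
  · have h2 : L ^ μ ≤ 4 ^ μ * ρ ^ μ := by
      rw [← Real.mul_rpow (by norm_num) hρ0.le]
      exact Real.rpow_le_rpow hL0.le (by linarith) hμ
    have h3 : 1 ≤ 4 ^ μ * L ^ (-μ) * ρ ^ μ := by
      calc 1 = L ^ μ * L ^ (-μ) := by rw [← Real.rpow_add hL0, add_neg_cancel, Real.rpow_zero]
        _ ≤ (4 ^ μ * ρ ^ μ) * L ^ (-μ) := by gcongr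
        _ = _ := by ring
    have : 0 ≤ 2 * (L ^ (γ - μ) * (√L)⁻¹) * (|ρ - L| * ρ ^ (μ - γ)) := by positivity
    linarith
  · have h3 : 3 / 4 * L ≤ |ρ - L| := by
      rw [abs_sub_comm]
      exact le_trans (by linarith) (le_abs_self _)
    -- The restriction μ ≤ 1/2 + γ is needed here, to make the exponent γ - μ + 1/2 of L nonnegative
    -- when γ ≤ μ.
    have h4 : 1 ≤ L ^ (γ - μ) * √L * ρ ^ (μ - γ) := by
      rw [Real.sqrt_eq_rpow, ← Real.rpow_add hL0]
      rcases le_or_gt γ μ with hc | hc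
      · exact one_le_mul_of_one_le_of_one_le (Real.one_le_rpow hL (by linarith))
          (Real.one_le_rpow hρ (by linarith))
      · calc (1 : ℝ) = ρ ^ (γ - μ) * ρ ^ (μ - γ) := by
              rw [← Real.rpow_add hρ0]; ring_nf; simp
          _ ≤ L ^ (γ - μ) * ρ ^ (μ - γ) := by
              gcongr
              linarith
          _ ≤ L ^ (γ - μ + 1 / 2) * ρ ^ (μ - γ) := by
              gcongr
              linarith
    have h5 : 2 * (L ^ (γ - μ) * (√L)⁻¹) * (3 / 4 * L * ρ ^ (μ - γ))
        ≤ 2 * (L ^ (γ - μ) * (√L)⁻¹) * (|ρ - L| * ρ ^ (μ - γ)) := by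
      gcongr
    have h6 : 2 * (L ^ (γ - μ) * (√L)⁻¹) * (3 / 4 * L * ρ ^ (μ - γ))
        = 3 / 2 * (L ^ (γ - μ) * √L * ρ ^ (μ - γ)) := by
      have hs : √L ≠ 0 := (Real.sqrt_pos.mpr hL0).ne'
      field_simp
      rw [Real.sq_sqrt hL0.le]; ring
    have : 0 ≤ 4 ^ μ * L ^ (-μ) * ρ ^ μ := by positivity
    linarith

/-! ### Resolvent bounds and bounds for the pencil. -/

namespace NonnegOperator

variable {H : Type*} [NormedAddCommGroup H] [InnerProductSpace ℂ H] [CompleteSpace H]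
variable (P : NonnegOperator H)
variable {Y : Type*} [NormedAddCommGroup Y] [InnerProductSpace ℂ Y] [CompleteSpace Y]
variable {γ : ℝ} (hγ : γ ≤ 1 / 2) (Q : P.Hs γ →L[ℂ] Y)

lemma norm_ιE_le (u : P.Hs (1 / 2)) : ‖P.ιE u‖ ≤ ‖u‖ := P.norm_incl_le _ u

lemma norm_state_sq (u : P.Hs (1 / 2)) (g : P.Hs 0) :
    ‖(WithLp.toLp 2 (u, g) : P.State)‖ ^ 2 = ‖u‖ ^ 2 + ‖g‖ ^ 2 := by
  exact WithLp.prod_norm_sq_eq_of_L2 _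

/-- An a priori bound for the pencils at `l` and `-l` yields a resolvent bound. -/
lemma resolventBound_of_pencil_bound {K l : ℝ} (hK : 1 ≤ K) (hl : 1 ≤ |l|)
    (h : ∀ (u : P.Hs (1 / 2)) (g : P.Hs 0),
      P.pencilE hγ Q l u = ContinuousLinearMap.adjoint P.ιE g → ‖P.ιE u‖ ≤ K / |l| * ‖g‖)
    (h' : ∀ (u : P.Hs (1 / 2)) (g : P.Hs 0),
      P.pencilE hγ Q (-l) u = ContinuousLinearMap.adjoint P.ιE g → ‖P.ιE u‖ ≤ K / |l| * ‖g‖) :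
    ResolventBound (P.generator hγ Q) (Complex.I * l) (16 * K) := by
  have hbij := bijective_pencil P.norm_ιE_le h h'
  let S : P.Hs (1 / 2) →ₗ[ℂ] P.Hs (1 / 2) := ((LinearEquiv.ofBijective
    (P.pencilE hγ Q l : P.Hs (1 / 2) →ₗ[ℂ] P.Hs (1 / 2)) hbij).symm).toLinearMap
  have hS : ∀ k, P.pencilE hγ Q l (S k) = k := fun k =>
    (LinearEquiv.ofBijective
    (P.pencilE hγ Q l : P.Hs (1 / 2) →ₗ[ℂ] P.Hs (1 / 2)) hbij).apply_symm_apply k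
  have hS' : ∀ u, S (P.pencilE hγ Q l u) = u := fun u => hbij.1 (hS _)
  let pf : P.State →ₗ[ℂ] P.Hs (1 / 2) := LinearMap.fst ℂ _ _ ∘ₗ
    (WithLp.linearEquiv 2 ℂ (P.Hs (1 / 2) × P.Hs 0)).toLinearMap
  let ps : P.State →ₗ[ℂ] P.Hs 0 := LinearMap.snd ℂ _ _ ∘ₗ
    (WithLp.linearEquiv 2 ℂ (P.Hs (1 / 2) × P.Hs 0)).toLinearMap
  let A1 : P.Hs (1 / 2) →ₗ[ℂ] P.Hs (1 / 2) :=
    (ContinuousLinearMap.adjoint P.ιE ∘L P.ιE : P.Hs (1 / 2) →L[ℂ] P.Hs (1 / 2))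
  let A2 : P.Hs 0 →ₗ[ℂ] P.Hs (1 / 2) :=
    (ContinuousLinearMap.adjoint P.ιE : P.Hs 0 →L[ℂ] P.Hs (1 / 2))
  let A3 : P.Hs (1 / 2) →ₗ[ℂ] P.Hs (1 / 2) :=
    (ContinuousLinearMap.adjoint (P.qE hγ Q) ∘L P.qE hγ Q : P.Hs (1 / 2) →L[ℂ] P.Hs (1 / 2))
  let U : P.State →ₗ[ℂ] P.Hs (1 / 2) :=
    S ∘ₗ ((Complex.I * l) • (A1 ∘ₗ pf) - A2 ∘ₗ ps - A3 ∘ₗ pf)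
  let V : P.State →ₗ[ℂ] P.Hs (1 / 2) := pf - (Complex.I * l) • U
  have hU : ∀ (f : P.Hs (1 / 2)) (g : P.Hs 0), U (WithLp.toLp 2 (f, g)) =
      S ((Complex.I * l) • ContinuousLinearMap.adjoint P.ιE (P.ιE f)
        - ContinuousLinearMap.adjoint P.ιE g
        - ContinuousLinearMap.adjoint (P.qE hγ Q) (P.qE hγ Q f)) := fun f g => rfl
  have hV : ∀ (f : P.Hs (1 / 2)) (g : P.Hs 0), V (WithLp.toLp 2 (f, g)) =
      f - (Complex.I * l) • U (WithLp.toLp 2 (f, g)) := fun f g => rfl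
  let R₀ : P.State →ₗ[ℂ] P.State := P.toState ∘ₗ LinearMap.prod U V
  have hR₀ : ∀ F, R₀ F = WithLp.toLp 2 (U F, P.ιE (V F)) := fun F => P.toState_apply _ _
  have hbound : ∀ F, ‖R₀ F‖ ≤ 16 * K * ‖F‖ := by
    intro F
    obtain ⟨f, g⟩ := F
    have e := hU f g
    obtain ⟨b1, b2⟩ := norm_solution_le hK hl P.norm_ιE_le h h' f (U (WithLp.toLp 2 (f, g))) g
      (by rw [e]; exact hS _)
    rw [← hV] at b2
    rw [hR₀]
    have e1 := P.norm_state_sq (U (WithLp.toLp 2 (f, g))) (P.ιE (V (WithLp.toLp 2 (f, g))))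
    have e2 := P.norm_state_sq f g
    set n := ‖(WithLp.toLp 2 (f, g) : P.State)‖
    have hn : 0 ≤ n := norm_nonneg _
    have hf : ‖f‖ ≤ n := abs_le_of_sq_le_sq' (by nlinarith [sq_nonneg ‖g‖]) hn |>.2
    have hg : ‖g‖ ≤ n := abs_le_of_sq_le_sq' (by nlinarith [sq_nonneg ‖f‖]) hn |>.2
    have c1 : ‖U (WithLp.toLp 2 (f, g))‖ ≤ 11 * (K * n) := by
      have : K * ‖f‖ ≤ K * n := by gcongr
      have : K * ‖g‖ ≤ K * n := by gcongr
      linarith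
    have c2 : ‖P.ιE (V (WithLp.toLp 2 (f, g)))‖ ≤ 5 * (K * n) := by
      have : K * ‖f‖ ≤ K * n := by gcongr
      have : K * ‖g‖ ≤ K * n := by gcongr
      linarith
    -- The constant 16 suffices since 11² + 5² = 146 ≤ 16².
    refine abs_le_of_sq_le_sq' ?_ (by positivity) |>.2
    rw [e1]
    have d1 := pow_le_pow_left₀ (norm_nonneg _) c1 2
    have d2 := pow_le_pow_left₀ (norm_nonneg _) c2 2
    nlinarith [sq_nonneg (K * n)]
  refine ⟨R₀.mkContinuous (16 * K) hbound,
    LinearMap.mkContinuous_norm_le _ (by positivity) _, ?_, ?_⟩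
  · rintro ⟨f, g⟩
    rw [LinearMap.mkContinuous_apply]
    set u := U (WithLp.toLp 2 (f, g)) with hu
    set v := V (WithLp.toLp 2 (f, g)) with hv
    have hvu : v + (Complex.I * l) • u = f := by rw [hv, hV]; abel
    have hg : -((Complex.I * l) • P.ιE v - g) + (Complex.I * l) • P.ιE v = g := by abel
    have hf := (P.force_eq_iff hγ Q u v _).mpr ((pencil_eq_iff P.ιE (P.qE hγ Q) l hvu hg).mpr
      (by rw [hu, hU]; exact hS _))
    obtain ⟨hx, ex⟩ := P.toState_mem hγ Q hf
    refine ⟨hx, ?_⟩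
    change P.generator hγ Q ⟨P.toState (u, v), hx⟩ + (Complex.I * l) • P.toState (u, v) = _
    rw [ex, toState_apply, ← WithLp.toLp_smul, ← WithLp.toLp_add, Prod.smul_mk, Prod.mk_add_mk,
      hvu, hg]
  · rintro ⟨x, hx⟩
    rw [LinearMap.mkContinuous_apply]
    obtain ⟨u, v, g', rfl, hf, ex⟩ := P.exists_of_mem_domain hγ Q hx
    rw [ex]
    change R₀ (_ + (Complex.I * l) • P.toState (u, v)) = P.toState (u, v)
    rw [toState_apply, ← WithLp.toLp_smul, ← WithLp.toLp_add, Prod.smul_mk, Prod.mk_add_mk]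
    have hp := (pencil_eq_iff P.ιE (P.qE hγ Q) l rfl rfl).mp ((P.force_eq_iff hγ Q u v g').mp hf)
    have eU : U (WithLp.toLp 2 (v + (Complex.I * l) • u, -g' + (Complex.I * l) • P.ιE v)) = u := by
      rw [hU, ← hp, hS']
    have eV : V (WithLp.toLp 2 (v + (Complex.I * l) • u, -g' + (Complex.I * l) • P.ιE v)) = v := by
      rw [hV, eU, add_sub_cancel_right]
    rw [hR₀, eU, eV]

/-- Solvability of the pencil equation from a resolvent bound. -/
lemma exists_of_resolventBound {K l : ℝ}
    (h : ResolventBound (P.generator hγ Q) (Complex.I * l) K) (f : P.Hs (1 / 2)) (g : P.Hs 0) :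
    ∃ u : P.Hs (1 / 2), P.pencilE hγ Q l u =
      (Complex.I * l) • ContinuousLinearMap.adjoint P.ιE (P.ιE f)
        - ContinuousLinearMap.adjoint P.ιE g
        - ContinuousLinearMap.adjoint (P.qE hγ Q) (P.qE hγ Q f) ∧
      ‖u‖ ≤ K * ‖(WithLp.toLp 2 (f, g) : P.State)‖ ∧
      ‖P.ιE (f - (Complex.I * l) • u)‖ ≤ K * ‖(WithLp.toLp 2 (f, g) : P.State)‖ := by
  obtain ⟨R, hR, h1, -⟩ := h
  obtain ⟨hx, ex⟩ := h1 (WithLp.toLp 2 (f, g))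
  have hn : ‖R (WithLp.toLp 2 (f, g))‖ ≤ K * ‖(WithLp.toLp 2 (f, g) : P.State)‖ :=
    R.le_of_opNorm_le hR _
  obtain ⟨u, v, g', e, hf, ey⟩ := P.exists_of_mem_domain hγ Q hx
  rw [ey, e, toState_apply, ← WithLp.toLp_smul, ← WithLp.toLp_add, Prod.smul_mk,
    Prod.mk_add_mk] at ex
  have ex' := Prod.mk.inj (WithLp.toLp_injective 2 ex)
  have hp := (pencil_eq_iff P.ιE (P.qE hγ Q) l ex'.1 ex'.2).mp ((P.force_eq_iff hγ Q u v g').mp hf)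
  have hv : f - (Complex.I * l) • u = v := by rw [← ex'.1, add_sub_cancel_right]
  have hsq := P.norm_state_sq u (P.ιE v)
  rw [← toState_apply, ← e] at hsq
  refine ⟨u, hp, (abs_le_of_sq_le_sq' ?_ (norm_nonneg _)).2.trans hn, ?_⟩
  · nlinarith [sq_nonneg ‖P.ιE v‖]
  · rw [hv]
    refine (abs_le_of_sq_le_sq' ?_ (norm_nonneg _)).2.trans hn
    nlinarith [sq_nonneg ‖u‖]

/-- A vector w in the kernel of the pencil yields the kernel element (w, -ilw) of A + il. -/
lemma pencilE_injective_of_resolventBound {K l : ℝ}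
    (h : ResolventBound (P.generator hγ Q) (Complex.I * l) K) :
    Function.Injective (P.pencilE hγ Q l) := by
  refine (injective_iff_map_eq_zero _).mpr fun w hw => ?_
  obtain ⟨R, -, -, h2⟩ := h
  have hvu : -(Complex.I * l) • w + (Complex.I * l) • w = 0 := by rw [neg_smul, neg_add_cancel]
  have hg : -((Complex.I * l) • P.ιE (-(Complex.I * l) • w))
      + (Complex.I * l) • P.ιE (-(Complex.I * l) • w) = 0 := neg_add_cancel _
  have hf := (P.force_eq_iff hγ Q w _ _).mpr ((pencil_eq_iff P.ιE (P.qE hγ Q) l hvu hg).mpr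
    (by rw [hw]; simp))
  obtain ⟨hx, ex⟩ := P.toState_mem hγ Q hf
  have h3 := h2 ⟨_, hx⟩
  rw [ex] at h3
  change R (_ + (Complex.I * l) • P.toState _) = P.toState _ at h3
  rw [toState_apply, ← WithLp.toLp_smul, ← WithLp.toLp_add, Prod.smul_mk, Prod.mk_add_mk,
    hvu, hg] at h3
  have h4 : (WithLp.toLp 2 ((0 : P.Hs (1 / 2)), (0 : P.Hs 0)) : P.State) = 0 := rfl
  rw [h4, map_zero] at h3
  exact (congrArg (fun x : P.State => x.fst) h3).symm

/-- With f = 0 the velocity is -ilu, so its bound controls |l|‖ιu‖, while the energy bound controls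
‖ιu‖. Together they cover ⟨l⟩ ≤ 1 + |l|, also for small l. -/
lemma exists_solution_adjoint {K l : ℝ}
    (h : ResolventBound (P.generator hγ Q) (Complex.I * l) K) (g : P.Hs 0) :
    ∃ u : P.Hs (1 / 2), P.pencilE hγ Q l u = ContinuousLinearMap.adjoint P.ιE g ∧
      ‖u‖ ≤ K * ‖g‖ ∧ √(1 + l ^ 2) * ‖P.ιE u‖ ≤ 2 * K * ‖g‖ := by
  obtain ⟨u, hu, b1, b2⟩ := P.exists_of_resolventBound hγ Q h 0 (-g)
  have hn : ‖(WithLp.toLp 2 ((0 : P.Hs (1 / 2)), -g) : P.State)‖ = ‖g‖ := by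
    have := P.norm_state_sq 0 (-g)
    rw [norm_zero, norm_neg] at this
    rw [← abs_of_nonneg (norm_nonneg g), ← abs_of_nonneg (norm_nonneg (WithLp.toLp 2 _)),
      ← sq_eq_sq_iff_abs_eq_abs]
    linarith
  rw [hn] at b1 b2
  refine ⟨u, by rw [hu]; simp, b1, ?_⟩
  rw [zero_sub, map_neg, norm_neg, map_smul, norm_smul] at b2
  have e : ‖Complex.I * (l : ℂ)‖ = |l| := by simp
  rw [e] at b2
  have hs : √(1 + l ^ 2) ≤ 1 + |l| := by
    rw [Real.sqrt_le_left (by positivity)]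
    nlinarith [sq_abs l, abs_nonneg l]
  have := P.norm_ιE_le u
  calc √(1 + l ^ 2) * ‖P.ιE u‖ ≤ (1 + |l|) * ‖P.ιE u‖ := by gcongr
    _ ≤ _ := by linarith

/-- The velocity of the system with data (k, 0) solves the pencil equation with right-hand side k -
ι†ιk; a solution for ι†ιk is added. -/
lemma exists_solution {K l : ℝ} (hK : 0 ≤ K)
    (h : ResolventBound (P.generator hγ Q) (Complex.I * l) K) (k : P.Hs (1 / 2)) :
    ∃ u : P.Hs (1 / 2), P.pencilE hγ Q l u = k ∧ ‖P.ιE u‖ ≤ 2 * K * ‖k‖ := by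
  obtain ⟨u, hu, -, b2⟩ := P.exists_of_resolventBound hγ Q h k 0
  have hn : ‖(WithLp.toLp 2 (k, (0 : P.Hs 0)) : P.State)‖ = ‖k‖ := by
    have := P.norm_state_sq k 0
    rw [norm_zero] at this
    rw [← abs_of_nonneg (norm_nonneg k), ← abs_of_nonneg (norm_nonneg (WithLp.toLp 2 _)),
      ← sq_eq_sq_iff_abs_eq_abs]
    linarith
  rw [hn] at b2
  rw [map_zero, sub_zero] at hu
  obtain ⟨u', hu', b1, -⟩ := P.exists_solution_adjoint hγ Q h (P.ιE k)
  refine ⟨k - (Complex.I * l) • u + u', ?_, ?_⟩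
  · rw [map_add, pencil_sub_smul P.ιE (P.qE hγ Q) l hu, hu', sub_add_cancel]
  · rw [map_add]
    have h1 := norm_add_le (P.ιE (k - (Complex.I * l) • u)) (P.ιE u')
    have h2 := P.norm_ιE_le u'
    have h3 : K * ‖P.ιE k‖ ≤ K * ‖k‖ := by gcongr; exact P.norm_ιE_le k
    linarith

end NonnegOperator
end DampedWave

end

noncomputable section

/-! ### From the control estimate to the resolvent bound. -/

namespace DampedWave

/-- Absorption of the remainder in the control estimate. -/
lemma le_add_of_control {M m C c q A₁ G s l x w y g a n : ℝ} (hc : 0 < c) (hM : c ≤ M)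
    (hm : c ≤ m) (hq : 0 ≤ q) (hA : 1 ≤ A₁) (hG : 1 ≤ G) (hl : 1 ≤ l) (hs : l ≤ s)
    (hy : 0 ≤ y) (hg : 0 ≤ g) (ha : 0 ≤ a) (hw : 0 ≤ w) (hn : 0 ≤ n)
    (h₁ : a ≤ g + l * (q * y)) (h₂ : w ≤ M * s⁻¹ * a + m * y + C * n)
    (h₃ : n ≤ 2 * (1 / (4 * (|C| + 1)) * w + 2 * s⁻¹ * a))
    (h₄ : x ≤ 2 * (A₁ * G * w + 2 * s⁻¹ * a)) :
    x ≤ 4 * A₁ * (1 + 4 * |C| / c + 1 / c) * (1 + q) * G * (M * (g / l) + (M + m) * y) := by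
  have hl0 : 0 < l := by linarith
  have hs0 : 0 < s := by linarith
  have hC := abs_nonneg C
  have hM0 : 0 < M := by linarith
  have hm0 : 0 < m := by linarith
  obtain ⟨b, hb⟩ : ∃ b, b = s⁻¹ * a := ⟨_, rfl⟩
  obtain ⟨t, ht⟩ : ∃ t, t = g / l := ⟨_, rfl⟩
  have ht0 : 0 ≤ t := by rw [ht]; positivity
  have hb0 : 0 ≤ b := by rw [hb]; positivity
  have hb1 : b ≤ t + q * y := by
    calc b ≤ l⁻¹ * (g + l * (q * y)) := by
          rw [hb]; gcongr
      _ = t + q * y := by rw [ht]; field_simp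
  have f4 : 2 * s⁻¹ * a = 2 * b := by rw [hb]; ring
  have f5 : M * s⁻¹ * a = M * b := by rw [hb]; ring
  rw [f4] at h₃ h₄
  rw [f5] at h₂
  -- The coefficient 1/(4(|C| + 1)) in `h₃` makes the contribution of w at most w/2, which the left
  -- side of `h₂` absorbs.
  have k1 : C * n ≤ w / 2 + 4 * |C| * b := by
    calc C * n ≤ |C| * n := by gcongr; exact le_abs_self C
      _ ≤ |C| * (2 * (1 / (4 * (|C| + 1)) * w + 2 * b)) := by gcongr
      _ = (|C| / (|C| + 1)) * (w / 2) + 4 * |C| * b := by field_simp; ring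
      _ ≤ 1 * (w / 2) + 4 * |C| * b := by
          gcongr
          exact (div_le_one (by positivity)).mpr (by linarith)
      _ = _ := by ring
  obtain ⟨c₂, hc₂⟩ : ∃ c₂, c₂ = 1 + 4 * |C| / c + 1 / c := ⟨_, rfl⟩
  have hc₂1 : 1 ≤ c₂ := by
    have : 0 ≤ 4 * |C| / c := by positivity
    have : 0 ≤ 1 / c := by positivity
    linarith
  have k2 : w ≤ 2 * (M + 4 * |C|) * b + 2 * m * y := by linarith
  have k3 : M + 4 * |C| + 1 ≤ c₂ * M := by
    have e1 : 4 * |C| ≤ 4 * |C| / c * M := by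
      calc 4 * |C| = 4 * |C| / c * c := by field_simp
        _ ≤ _ := by gcongr
    have e2 : 1 ≤ 1 / c * M := by
      calc (1 : ℝ) = 1 / c * c := by field_simp
        _ ≤ _ := by gcongr
    rw [hc₂]; linarith
  have hAG : 1 ≤ A₁ * G := one_le_mul_of_one_le_of_one_le hA hG
  have k4 : x ≤ 4 * (A₁ * G) * (c₂ * M * b + m * y) := by
    have f1 : A₁ * G * w ≤ A₁ * G * (2 * (M + 4 * |C|) * b + 2 * m * y) := by gcongr
    have f2 : b ≤ A₁ * G * b := le_mul_of_one_le_left hb0 hAG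
    have f3 : A₁ * G * ((M + 4 * |C| + 1) * b) ≤ A₁ * G * (c₂ * M * b) := by gcongr
    linarith
  have k5 : c₂ * M * b + m * y ≤ c₂ * (1 + q) * (M * t + (M + m) * y) := by
    have g1 : c₂ * M * b ≤ c₂ * M * (t + q * y) := by gcongr
    have g2 : m * y ≤ c₂ * (m * y) := le_mul_of_one_le_left (by positivity) hc₂1
    have g3 : 0 ≤ c₂ * (q * (M * t)) := by positivity
    have g4 : 0 ≤ c₂ * (q * (m * y)) := by positivity
    have g5 : 0 ≤ c₂ * (M * y) := by positivity
    linarith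
  rw [← hc₂, ← ht]
  calc x ≤ 4 * (A₁ * G) * (c₂ * M * b + m * y) := k4
    _ ≤ 4 * (A₁ * G) * (c₂ * (1 + q) * (M * t + (M + m) * y)) := by gcongr
    _ = _ := by ring

/-- Absorption of the damping term in the control estimate. -/
lemma le_of_le_add_damping {M m c A G l x y g : ℝ} (hc : 0 < c) (hM : c ≤ M) (hm : c ≤ m)
    (hA : 0 ≤ A) (hG : 1 ≤ G) (hl : 0 < l) (hx : 0 ≤ x) (hg : 0 ≤ g)
    (h : x ≤ A * G * (M * (g / l) + (M + m) * y)) (hy : l * y ^ 2 ≤ g * x) :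
    x ≤ (2 * A / c + 2 * A ^ 2) * G ^ 2 * (M ^ 2 + m ^ 2) * (g / l) := by
  have hM0 : 0 < M := by linarith
  have hm0 : 0 < m := by linarith
  have hy2 : y ^ 2 ≤ g / l * x := by
    rw [div_mul_eq_mul_div, le_div_iff₀ hl]; linarith
  obtain ⟨t, ht⟩ : ∃ t, t = g / l := ⟨_, rfl⟩
  have ht0 : 0 ≤ t := by rw [ht]; positivity
  rw [← ht] at h hy2 ⊢
  obtain ⟨S, hS⟩ : ∃ S, S = A * G * (M + m) := ⟨_, rfl⟩
  have hS0 : 0 ≤ S := by rw [hS]; positivity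
  -- Since y² ≤ tx, the square of the left side is at most 4(x/2)(S²t/2), which is at most the
  -- square of the right side.
  have k6 : S * y ≤ x / 2 + S ^ 2 * t / 2 := by
    refine abs_le_of_sq_le_sq' ?_ (by positivity) |>.2
    have : S ^ 2 * y ^ 2 ≤ S ^ 2 * (t * x) := by gcongr
    have h0 := sq_nonneg (x / 2 - S ^ 2 * t / 2)
    rw [mul_pow]
    linarith
  have k7 : x ≤ 2 * (A * G * (M * t)) + S ^ 2 * t := by
    have : A * G * ((M + m) * y) = S * y := by rw [hS]; ring
    linarith
  have hG2 : G ≤ G ^ 2 := le_self_pow₀ hG two_ne_zero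
  have k8 : A * G * (M * t) ≤ A / c * G ^ 2 * (M ^ 2 + m ^ 2) * t := by
    have f1 : M ≤ (M ^ 2 + m ^ 2) / c := by
      rw [le_div_iff₀ hc]
      have : M * c ≤ M * M := by gcongr
      nlinarith [sq_nonneg m]
    calc A * G * (M * t) ≤ A * G ^ 2 * ((M ^ 2 + m ^ 2) / c * t) := by gcongr
      _ = _ := by ring
  have k9 : S ^ 2 * t ≤ 2 * A ^ 2 * G ^ 2 * (M ^ 2 + m ^ 2) * t := by
    have f1 : (M + m) ^ 2 ≤ 2 * (M ^ 2 + m ^ 2) := add_sq_le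
    calc S ^ 2 * t = A ^ 2 * G ^ 2 * (M + m) ^ 2 * t := by rw [hS]; ring
      _ ≤ A ^ 2 * G ^ 2 * (2 * (M ^ 2 + m ^ 2)) * t := by gcongr
      _ = _ := by ring
  calc x ≤ 2 * (A / c * G ^ 2 * (M ^ 2 + m ^ 2) * t)
        + 2 * A ^ 2 * G ^ 2 * (M ^ 2 + m ^ 2) * t := by linarith
    _ = _ := by ring

namespace NonnegOperator

variable {H : Type*} [NormedAddCommGroup H] [InnerProductSpace ℂ H] [CompleteSpace H]
variable (P : NonnegOperator H)
variable {Y : Type*} [NormedAddCommGroup Y] [InnerProductSpace ℂ Y] [CompleteSpace Y]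
variable {γ : ℝ} (hγ : γ ≤ 1 / 2) (Q : P.Hs γ →L[ℂ] Y)

omit [CompleteSpace Y] in
lemma qE_apply_eq (u : P.Hs (1 / 2)) {x : P.Expansion} (hx : x ∈ P.Hs γ)
    (h : x = (u : P.Expansion)) : P.qE hγ Q u = Q ⟨x, hx⟩ := by
  rw [ContinuousLinearMap.comp_apply]
  congr 1
  exact Subtype.ext ((P.coe_incl hγ u).trans h.symm)

/-- Elliptic regularity, from Λu = (P - c)u + (1 + c)u. -/
lemma mem_of_opSub_mem {c s t : ℝ} {u : P.Expansion} (hs : u ∈ P.Hs s) (h : t ≤ s)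
    (hu : P.opSub c u ∈ P.Hs t) : u ∈ P.Hs (t + 1) := by
  rw [← Lam_mem_iff, P.Lam_one_eq c]
  exact (P.Hs t).add_mem hu ((P.Hs t).smul_mem _ (P.mem_of_le h hs))

/-- The undamped part of the pencil equation, in `H_{-γ}`. -/
lemma opSub_of_pencilE (hγ₀ : 0 ≤ γ) {l : ℝ} {u : P.Hs (1 / 2)} {g : P.Hs 0}
    (h : P.pencilE hγ Q l u = ContinuousLinearMap.adjoint P.ιE g) :
    ∃ hm : P.opSub (l ^ 2) u ∈ P.Hs (-γ),
      ‖(⟨_, hm⟩ : P.Hs (-γ))‖ ≤ ‖g‖ + |l| * (‖Q‖ * ‖P.qE hγ Q u‖) := by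
  have e : P.opSub (l ^ 2) u =
      (g : P.Expansion) + (Complex.I * l) • P.Qstar Q (P.qE hγ Q u) := by
    have h1 := P.Lam_one_pencilE hγ Q l u
    rw [h, Lam_one_adjoint_ιE] at h1
    rw [h1, sub_add_cancel]
  let y : P.Hs (-γ) := ⟨P.Qstar Q (P.qE hγ Q u), P.Qstar_mem Q _⟩
  let z : P.Hs (-γ) := P.incl (by linarith) g + (Complex.I * l) • y
  have ez : (z : P.Expansion) = P.opSub (l ^ 2) u := by
    rw [e, Submodule.coe_add, Submodule.coe_smul, coe_incl]
  have hm : P.opSub (l ^ 2) u ∈ P.Hs (-γ) := ez ▸ z.2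
  refine ⟨hm, ?_⟩
  have e' : (⟨_, hm⟩ : P.Hs (-γ)) = z := Subtype.ext ez.symm
  rw [e']
  refine (norm_add_le _ _).trans (add_le_add (P.norm_incl_le _ g) ?_)
  rw [norm_smul]
  have : ‖Complex.I * (l : ℂ)‖ = |l| := by simp
  rw [this]
  gcongr
  exact P.norm_Qstar_le Q _

lemma pencil_bound_of_controlEstimate (hγ₀ : 0 ≤ γ) {μ : ℝ} (hμ : 0 ≤ μ) {M m : ℝ → ℝ}
    (h : P.ControlEstimate hγ Q μ hμ M m) :
    ∃ l₀ ≥ (1 : ℝ), ∃ A > 0, ∀ l : ℝ, l₀ ≤ |l| → ∀ (u : P.Hs (1 / 2)) (g : P.Hs 0),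
      P.pencilE hγ Q l u = ContinuousLinearMap.adjoint P.ιE g →
      ‖P.ιE u‖ ≤ A * (|l| ^ (2 * μ)) ^ 2 * (M |l| ^ 2 + m |l| ^ 2) * (‖g‖ / |l|) := by
  obtain ⟨-, -, ⟨c, hc, hMm⟩, l₁, hl₁, N, hN, C, hcontrol⟩ := h
  obtain ⟨L₀, hL₀, habs⟩ := rpow_neg_le_add (ε := 1 / (4 * (|C| + 1))) hN (by positivity) hμ hγ
  have h8 : (1 : ℝ) ≤ 4 ^ μ * 2 ^ μ := one_le_mul_of_one_le_of_one_le
    (Real.one_le_rpow (by norm_num) hμ) (Real.one_le_rpow (by norm_num) hμ)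
  obtain ⟨A, hA⟩ : ∃ A, A = 4 * (4 ^ μ * 2 ^ μ) * (1 + 4 * |C| / c + 1 / c) * (1 + ‖Q‖) := ⟨_, rfl⟩
  have hA0 : 0 < A := by rw [hA]; positivity
  refine ⟨max l₁ (max L₀ 1), (le_max_right _ _).trans' (le_max_right _ _), 2 * A / c + 2 * A ^ 2,
    by positivity, fun l hl u g hu => ?_⟩
  have hl1 : 1 ≤ |l| := ((le_max_right _ _).trans (le_max_right _ _)).trans hl
  have hll₁ : l₁ ≤ |l| := (le_max_left _ _).trans hl
  have hlL : L₀ ≤ 1 + l ^ 2 := by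
    have : L₀ ≤ |l| := ((le_max_left _ _).trans (le_max_right _ _)).trans hl
    nlinarith [sq_abs l]
  obtain ⟨hM, hm⟩ := hMm |l| (abs_nonneg l)
  obtain ⟨hmem, hnorm⟩ := P.opSub_of_pencilE hγ Q hγ₀ hu
  -- A solution in H_{1/2} is in fact in H_{1-γ}, exactly the regularity that makes Λ^{-μ}u
  -- admissible in the control estimate.
  have hu1 : (u : P.Expansion) ∈ P.Hs (-γ + 1) :=
    P.mem_of_opSub_mem u.2 (by linarith) hmem
  have hwmem : P.Lam (-μ) u ∈ P.Hs (1 + μ - γ) := P.Lam_mem (by linarith) hu1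
  have key := hcontrol |l| hll₁ ⟨P.Lam (-μ) u, hwmem⟩
  have hLμ : P.Lam μ (P.Lam (-μ) u) = (u : P.Expansion) := by
    rw [Lam_Lam, add_neg_cancel, Lam_zero]
  have hLμγ : P.Lam (μ - γ) (P.Lam (-μ) u) = P.Lam (-γ) (u : P.Expansion) := by
    rw [Lam_Lam]; congr 2; ring
  have ha : ∀ hx, ‖(⟨P.opSub (|l| ^ 2) (P.Lam (μ - γ) (P.Lam (-μ) u)), hx⟩ : P.Hs 0)‖
      = ‖(⟨P.opSub (l ^ 2) u, hmem⟩ : P.Hs (-γ))‖ := fun hx =>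
    P.norm_congr _ _ (by rw [hLμγ, sq_abs, Lam_zero, Lam_opSub])
  have hy := P.qE_apply_eq hγ Q u (x := P.Lam μ (P.Lam (-μ) u))
    (P.Lam_mem (by linarith) hwmem) hLμ
  rw [ha, ← hy, sq_abs] at key
  have hw0 : P.Lam (-μ) u ∈ P.Hs 0 := P.mem_of_le (by linarith) hwmem
  have hNmem : P.Lam (-N) (P.Lam (-μ) u) ∈ P.Hs 0 := P.Lam_mem (by linarith) hwmem
  have hu0 : (u : P.Expansion) ∈ P.Hs 0 := P.mem_of_le (by norm_num) u.2
  have hρ : ∀ κ : ℝ≥0, (1 : ℝ) ≤ 1 + κ := fun κ => by simp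
  have hsub : ∀ κ : ℝ≥0, |(κ : ℝ) - l ^ 2| = |1 + (κ : ℝ) - (1 + l ^ 2)| := fun κ => by
    congr 1; ring
  have h3 : ‖(⟨_, hNmem⟩ : P.Hs 0)‖ ≤ 2 * (1 / (4 * (|C| + 1)) * ‖(⟨_, hw0⟩ : P.Hs 0)‖
      + 2 * (√(1 + l ^ 2))⁻¹ * ‖(⟨_, hmem⟩ : P.Hs (-γ))‖) := by
    refine P.norm_le_add_of_apply_le (by positivity) (by positivity) hNmem hw0 hmem fun κ => ?_
    have hκ := habs (1 + l ^ 2) hlL (1 + κ) (hρ κ)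
    have hκ' := mul_le_mul_of_nonneg_right hκ
      (by positivity : 0 ≤ (1 + (κ : ℝ)) ^ (-μ) * ‖(u : P.Expansion) κ‖)
    have e1 : (1 + (κ : ℝ)) ^ (-γ) = (1 + (κ : ℝ)) ^ (μ - γ) * (1 + (κ : ℝ)) ^ (-μ) := by
      rw [← Real.rpow_add (by positivity)]; congr 1; ring
    rw [norm_Lam_apply, norm_Lam_apply, norm_opSub_apply, Real.rpow_zero, hsub, e1]
    linarith
  have h4 : ‖(⟨_, hu0⟩ : P.Hs 0)‖ ≤ 2 * (4 ^ μ * (1 + l ^ 2) ^ μ * ‖(⟨_, hw0⟩ : P.Hs 0)‖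
      + 2 * (√(1 + l ^ 2))⁻¹ * ‖(⟨_, hmem⟩ : P.Hs (-γ))‖) := by
    refine P.norm_le_add_of_apply_le (by positivity) (by positivity) hu0 hw0 hmem fun κ => ?_
    have hκ := one_le_low_add_high (L := 1 + l ^ 2) (by nlinarith) (hρ κ) hμ hγ
    have hκ' := mul_le_mul_of_nonneg_right hκ (norm_nonneg ((u : P.Expansion) κ))
    rw [norm_Lam_apply, norm_opSub_apply, Real.rpow_zero, hsub]
    linarith
  have eu : P.ιE u = ⟨_, hu0⟩ := Subtype.ext (P.coe_incl _ u)
  have h5 := damping_le_of_pencil_eq_adjoint _ _ l u g hu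
  rw [eu] at h5 ⊢
  have hL : (1 + l ^ 2) ^ μ ≤ 2 ^ μ * |l| ^ (2 * μ) := by
    have e : |l| ^ (2 * μ) = (l ^ 2) ^ μ := by
      rw [Real.rpow_mul (abs_nonneg l), Real.rpow_two, sq_abs]
    rw [e, ← Real.mul_rpow (by norm_num) (sq_nonneg l)]
    exact Real.rpow_le_rpow (by positivity) (by nlinarith [sq_abs l]) hμ
  have h4' : ‖(⟨_, hu0⟩ : P.Hs 0)‖ ≤ 2 * ((4 ^ μ * 2 ^ μ) * |l| ^ (2 * μ)
      * ‖(⟨_, hw0⟩ : P.Hs 0)‖ + 2 * (√(1 + l ^ 2))⁻¹ * ‖(⟨_, hmem⟩ : P.Hs (-γ))‖) := by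
    refine h4.trans ?_
    have : 4 ^ μ * (1 + l ^ 2) ^ μ ≤ 4 ^ μ * 2 ^ μ * |l| ^ (2 * μ) := by
      rw [mul_assoc]; gcongr
    gcongr
  have hs : |l| ≤ √(1 + l ^ 2) := Real.abs_le_sqrt (by linarith)
  have hG : 1 ≤ |l| ^ (2 * μ) := Real.one_le_rpow hl1 (by linarith)
  have h6 := le_add_of_control hc hM hm (norm_nonneg Q) h8 hG hl1 hs (norm_nonneg _)
    (norm_nonneg _) (norm_nonneg _) (norm_nonneg _) (norm_nonneg _) hnorm key h3 h4'
  rw [← hA] at h6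
  exact le_of_le_add_damping hc hM hm hA0.le hG (by linarith) (norm_nonneg _) (norm_nonneg _)
    h6 h5

/-- A control estimate implies a resolvent estimate. -/
lemma resolventBound_of_controlEstimate (hγ₀ : 0 ≤ γ) {μ : ℝ} (hμ : 0 ≤ μ) {M m : ℝ → ℝ}
    (h : P.ControlEstimate hγ Q μ hμ M m) :
    ∃ l₀ > 0, ∃ C > 0, ∀ l : ℝ, l₀ ≤ |l| →
      ResolventBound (P.generator hγ Q) (Complex.I * l)
        (C * |l| ^ (4 * μ) * (M |l| ^ 2 + m |l| ^ 2)) := by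
  obtain ⟨l₀, hl₀, A, hA, hb⟩ := P.pencil_bound_of_controlEstimate hγ Q hγ₀ hμ h
  obtain ⟨-, -, ⟨c, hc, hMm⟩, -⟩ := h
  -- Adding 1/c² to A guarantees K ≥ 1 below, as M² + m² ≥ c².
  refine ⟨l₀, by linarith, 16 * (A + 1 / c ^ 2), by positivity, fun l hl => ?_⟩
  have hl1 : 1 ≤ |l| := hl₀.trans hl
  obtain ⟨hM, hm⟩ := hMm |l| (abs_nonneg l)
  have e : (|l| ^ (2 * μ)) ^ 2 = |l| ^ (4 * μ) := by
    rw [← Real.rpow_natCast, ← Real.rpow_mul (abs_nonneg l)]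
    congr 1; push_cast; ring
  have hG : 1 ≤ |l| ^ (4 * μ) := Real.one_le_rpow hl1 (by linarith)
  have hS : c ^ 2 ≤ M |l| ^ 2 + m |l| ^ 2 := by
    have : c ^ 2 ≤ M |l| ^ 2 := by gcongr
    nlinarith [sq_nonneg (m |l|)]
  set S := M |l| ^ 2 + m |l| ^ 2
  have hS0 : 0 < S := lt_of_lt_of_le (by positivity) hS
  set K := (A + 1 / c ^ 2) * |l| ^ (4 * μ) * S with hKdef
  have hK : 1 ≤ K := by
    calc (1 : ℝ) = 1 / c ^ 2 * 1 * c ^ 2 := by field_simp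
      _ ≤ (A + 1 / c ^ 2) * |l| ^ (4 * μ) * S := by gcongr; linarith
  have hKA : A * (|l| ^ (2 * μ)) ^ 2 * S ≤ K := by
    rw [e, hKdef]
    gcongr
    have : 0 < 1 / c ^ 2 := by positivity
    linarith
  have hbound : ∀ (u : P.Hs (1 / 2)) (g : P.Hs 0),
      ‖P.ιE u‖ ≤ A * (|l| ^ (2 * μ)) ^ 2 * S * (‖g‖ / |l|) → ‖P.ιE u‖ ≤ K / |l| * ‖g‖ := by
    intro u g hug
    calc ‖P.ιE u‖ ≤ A * (|l| ^ (2 * μ)) ^ 2 * S * (‖g‖ / |l|) := hug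
      _ ≤ K * (‖g‖ / |l|) := by gcongr
      _ = _ := by ring
  have := P.resolventBound_of_pencil_bound hγ Q hK hl1 (fun u g hu => hbound u g (hb l hl u g hu))
    (fun u g hu => hbound u g (by
      have := hb (-l) (by rwa [abs_neg]) u g hu
      rwa [abs_neg] at this))
  have e' : 16 * (A + 1 / c ^ 2) * |l| ^ (4 * μ) * S = 16 * K := by rw [hKdef]; ring
  rwa [e']

/-! ### From the resolvent bound to the control estimate. -/

/-- The bound in `H` on solutions of the pencil equation with right-hand side `k ∈ H_{1-γ}`, by
splitting `k` at the frequency `⟨l⟩`. -/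
lemma norm_le_of_resolventBound (hγ₀ : 0 ≤ γ) {K l : ℝ} (hK : 0 ≤ K)
    (h : ResolventBound (P.generator hγ Q) (Complex.I * l) K) (w : P.Hs (1 / 2))
    (hF : P.Lam 1 (P.pencilE hγ Q l w) ∈ P.Hs (-γ)) :
    ‖P.ιE w‖ ≤ 4 * K * ((1 + l ^ 2) ^ γ * (√(1 + l ^ 2))⁻¹) * ‖(⟨_, hF⟩ : P.Hs (-γ))‖ := by
  set L := 1 + l ^ 2 with hLdef
  have hL1 : 1 ≤ L := by rw [hLdef]; nlinarith
  have hL0 : 0 < L := by linarith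
  have hs0 : 0 < √L := Real.sqrt_pos.mpr hL0
  set F := P.Lam 1 (P.pencilE hγ Q l w) with hFdef
  set b := ‖(⟨F, hF⟩ : P.Hs (-γ))‖
  have hb0 : 0 ≤ b := norm_nonneg _
  -- At the cut 1 + κ = L both halves cost the same: F₁ in H costs L^γ, with a further L^{-1/2} from
  -- `exists_solution_adjoint`, and Λ⁻¹F₂ in H_{1/2} costs L^{γ-1/2}.
  let F₁ : P.Expansion := P.fn (fun x => if 1 + x ≤ L then 1 else 0) F
  let F₂ : P.Expansion := P.fn (fun x => if 1 + x ≤ L then 0 else 1) F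
  have hsum : F = F₁ + F₂ := by
    funext κ
    change F κ = ((if 1 + (κ : ℝ) ≤ L then (1 : ℝ) else 0 : ℝ) : ℂ) • F κ
      + ((if 1 + (κ : ℝ) ≤ L then (0 : ℝ) else 1 : ℝ) : ℂ) • F κ
    split_ifs <;> simp
  have i1 : ∀ κ : ℝ≥0, (1 + (κ : ℝ)) ^ (0 : ℝ) * ‖F₁ κ‖
      ≤ L ^ γ * ((1 + (κ : ℝ)) ^ (-γ) * ‖F κ‖) := by
    intro κ
    rw [norm_fn_apply, Real.rpow_zero, one_mul]
    have hρ : (0 : ℝ) < 1 + κ := by positivity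
    split_ifs with hκ
    · rw [abs_one, one_mul, ← mul_assoc]
      refine le_mul_of_one_le_left (norm_nonneg _) ?_
      calc (1 : ℝ) = (1 + (κ : ℝ)) ^ γ * (1 + (κ : ℝ)) ^ (-γ) := by
            rw [← Real.rpow_add hρ, add_neg_cancel, Real.rpow_zero]
        _ ≤ _ := by gcongr
    · rw [abs_zero, zero_mul]; positivity
  have i2 : ∀ κ : ℝ≥0, (1 + (κ : ℝ)) ^ (1 / 2 : ℝ) * ‖P.Lam (-1) F₂ κ‖
      ≤ (L ^ γ * (√L)⁻¹) * ((1 + (κ : ℝ)) ^ (-γ) * ‖F κ‖) := by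
    intro κ
    rw [norm_Lam_apply, norm_fn_apply, inv_sqrt_eq_rpow hL0.le, ← Real.rpow_add hL0]
    have hρ : (0 : ℝ) < 1 + κ := by positivity
    split_ifs with hκ
    · rw [abs_zero, zero_mul, mul_zero, mul_zero]; positivity
    · rw [abs_one, one_mul, ← mul_assoc, ← mul_assoc, ← Real.rpow_add hρ]
      refine mul_le_mul_of_nonneg_right ?_ (norm_nonneg _)
      calc (1 + (κ : ℝ)) ^ (1 / 2 + -1 : ℝ)
          = (1 + (κ : ℝ)) ^ (γ + -(1 / 2)) * (1 + (κ : ℝ)) ^ (-γ) := by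
            rw [← Real.rpow_add hρ]; congr 1; ring
        _ ≤ _ := by
            refine mul_le_mul_of_nonneg_right ?_ (by positivity)
            exact Real.rpow_le_rpow_of_nonpos hL0 (by linarith) (by linarith)
  have m1 : F₁ ∈ P.Hs 0 := P.memHs_of_le hF i1
  have m2 : P.Lam (-1) F₂ ∈ P.Hs (1 / 2) := P.memHs_of_le hF i2
  have n1 := P.norm_le_of_apply_le (by positivity) m1 hF i1
  have n2 := P.norm_le_of_apply_le (by positivity) m2 hF i2
  obtain ⟨u₁, e1, -, b1⟩ := P.exists_solution_adjoint hγ Q h ⟨F₁, m1⟩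
  obtain ⟨u₂, e2, b2⟩ := P.exists_solution hγ Q hK h ⟨_, m2⟩
  have ew : w = u₁ + u₂ := by
    refine P.pencilE_injective_of_resolventBound hγ Q h ?_
    rw [map_add, e1, e2]
    refine Subtype.ext (P.Lam_injective 1 ?_)
    rw [Submodule.coe_add, map_add, Lam_one_adjoint_ιE, Lam_Lam, add_neg_cancel, Lam_zero]
    exact hsum
  have c1 : ‖P.ιE u₁‖ ≤ 2 * K * (L ^ γ * (√L)⁻¹) * b := by
    refine le_of_mul_le_mul_left ?_ hs0
    calc √L * ‖P.ιE u₁‖ ≤ 2 * K * ‖(⟨F₁, m1⟩ : P.Hs 0)‖ := b1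
      _ ≤ 2 * K * (L ^ γ * b) := by gcongr
      _ = _ := by field_simp
  have c2 : ‖P.ιE u₂‖ ≤ 2 * K * (L ^ γ * (√L)⁻¹) * b := by
    calc ‖P.ιE u₂‖ ≤ 2 * K * ‖(⟨_, m2⟩ : P.Hs (1 / 2))‖ := b2
      _ ≤ 2 * K * (L ^ γ * (√L)⁻¹ * b) := by gcongr
      _ = _ := by ring
  rw [ew, map_add]
  have := norm_add_le (P.ιE u₁) (P.ιE u₂)
  linarith

/-- A resolvent estimate implies a control estimate. -/
lemma control_of_resolventBound (hγ₀ : 0 ≤ γ) {C' : ℝ} (hC' : 0 < C') {μ : ℝ} (hμ : 0 ≤ μ)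
    (hμγ : μ ≤ 1 / 2 + γ) {K l : ℝ} (hK : C' ≤ K)
    (h : ResolventBound (P.generator hγ Q) (Complex.I * l) K) {u : P.Expansion}
    (hu : u ∈ P.Hs (1 / 2 + μ)) (hu0 : u ∈ P.Hs 0) (huμ : P.Lam μ u ∈ P.Hs γ)
    (hP : P.opSub (l ^ 2) (P.Lam (μ - γ) u) ∈ P.Hs 0) :
    ‖(⟨u, hu0⟩ : P.Hs 0)‖ ≤ (2 * (4 * 4 ^ μ * (1 + ‖Q‖) + 2 / C')) *
      √(1 + l ^ 2) ^ (2 * (γ - μ)) * K *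
        ((√(1 + l ^ 2))⁻¹ * ‖(⟨_, hP⟩ : P.Hs 0)‖ + ‖Q ⟨_, huμ⟩‖) := by
  have hL1 : 1 ≤ 1 + l ^ 2 := by nlinarith
  have hL0 : 0 < 1 + l ^ 2 := by linarith
  have hs0 : 0 < √(1 + l ^ 2) := Real.sqrt_pos.mpr hL0
  have hK0 : 0 < K := by linarith
  let w : P.Hs (1 / 2) := ⟨P.Lam μ u, P.Lam_mem le_rfl hu⟩
  have hy : P.qE hγ Q w = Q ⟨_, huμ⟩ := P.qE_apply_eq hγ Q w huμ rfl
  have hw0 : P.Lam μ u ∈ P.Hs 0 := P.mem_of_le (by norm_num) w.2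
  have ew : P.ιE w = ⟨_, hw0⟩ := Subtype.ext (P.coe_incl _ w)
  set y := ‖Q ⟨_, huμ⟩‖
  set n := ‖(⟨_, hP⟩ : P.Hs 0)‖
  have hn0 : 0 ≤ n := norm_nonneg _
  have hy0 : 0 ≤ y := norm_nonneg _
  -- the right-hand side in `H_{-γ}`
  have eG : P.opSub (l ^ 2) (P.Lam μ u) = P.Lam γ (P.opSub (l ^ 2) (P.Lam (μ - γ) u)) := by
    rw [Lam_opSub, Lam_Lam, add_sub_cancel]
  have hG : P.opSub (l ^ 2) (P.Lam μ u) ∈ P.Hs (-γ) := by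
    rw [eG]; exact P.Lam_mem (by linarith) hP
  have nG : ‖(⟨_, hG⟩ : P.Hs (-γ))‖ = n := by
    refine P.norm_congr _ _ ?_
    rw [eG, Lam_Lam, neg_add_cancel]
  let z : P.Hs (-γ) := ⟨_, hG⟩ - (Complex.I * l) • ⟨P.Qstar Q (P.qE hγ Q w), P.Qstar_mem Q _⟩
  have ez : (z : P.Expansion) = P.Lam 1 (P.pencilE hγ Q l w) := by
    rw [Lam_one_pencilE, Submodule.coe_sub, Submodule.coe_smul]
  have hF : P.Lam 1 (P.pencilE hγ Q l w) ∈ P.Hs (-γ) := ez ▸ z.2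
  have nF : ‖(⟨_, hF⟩ : P.Hs (-γ))‖ ≤ n + |l| * (‖Q‖ * y) := by
    have e' : (⟨_, hF⟩ : P.Hs (-γ)) = z := Subtype.ext ez.symm
    rw [e']
    refine (norm_sub_le _ _).trans (add_le_add nG.le ?_)
    rw [norm_smul]
    have : ‖Complex.I * (l : ℂ)‖ = |l| := by simp
    rw [this]
    gcongr
    refine (P.norm_Qstar_le Q _).trans ?_
    rw [hy]
  have b1 := P.norm_le_of_resolventBound hγ Q hγ₀ hK0.le h w hF
  rw [ew] at b1
  have b2 : ‖(⟨u, hu0⟩ : P.Hs 0)‖ ≤ 2 * (4 ^ μ * (1 + l ^ 2) ^ (-μ) * ‖(⟨_, hw0⟩ : P.Hs 0)‖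
      + 2 * ((1 + l ^ 2) ^ (γ - μ) * (√(1 + l ^ 2))⁻¹) * n) := by
    refine P.norm_le_add_of_apply_le (by positivity) (by positivity) hu0 hw0 hP fun κ => ?_
    have hκ := one_le_high_add_low (L := 1 + l ^ 2) (ρ := 1 + κ) hL1 (by simp) hμ hμγ
    have hκ' := mul_le_mul_of_nonneg_right hκ (norm_nonneg (u κ))
    have hsub : |(κ : ℝ) - l ^ 2| = |1 + (κ : ℝ) - (1 + l ^ 2)| := by congr 1; ring
    rw [norm_Lam_apply, norm_opSub_apply, norm_Lam_apply, Real.rpow_zero, hsub]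
    linarith
  have hs : |l| ≤ √(1 + l ^ 2) := Real.abs_le_sqrt (by linarith)
  have e1 : √(1 + l ^ 2) ^ (2 * (γ - μ)) = (1 + l ^ 2) ^ (γ - μ) := by
    rw [Real.rpow_mul hs0.le, Real.rpow_two, Real.sq_sqrt hL0.le]
  have e2 : (1 + l ^ 2) ^ (γ - μ) = (1 + l ^ 2) ^ γ * (1 + l ^ 2) ^ (-μ) := by
    rw [← Real.rpow_add hL0, sub_eq_add_neg]
  rw [e1]
  set s := √(1 + l ^ 2)
  set E := s⁻¹ * n + y with hE
  have hE0 : 0 ≤ E := by positivity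
  have b3 : s⁻¹ * ‖(⟨_, hF⟩ : P.Hs (-γ))‖ ≤ (1 + ‖Q‖) * E := by
    calc s⁻¹ * ‖(⟨_, hF⟩ : P.Hs (-γ))‖ ≤ s⁻¹ * (n + s * (‖Q‖ * y)) := by
          gcongr
          exact nF.trans (by gcongr)
      _ = s⁻¹ * n + ‖Q‖ * y := by field_simp
      _ ≤ _ := by
          have : 0 ≤ ‖Q‖ * (s⁻¹ * n) := by positivity
          rw [hE]; linarith
  have b4 : ‖(⟨_, hw0⟩ : P.Hs 0)‖ ≤ 4 * K * (1 + l ^ 2) ^ γ * ((1 + ‖Q‖) * E) := by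
    calc _ ≤ _ := b1
      _ = 4 * K * (1 + l ^ 2) ^ γ * (s⁻¹ * ‖(⟨_, hF⟩ : P.Hs (-γ))‖) := by ring
      _ ≤ _ := by gcongr
  -- The far-frequency term carries no factor K; the lower bound C' ≤ K inserts one.
  have b5 : s⁻¹ * n ≤ K / C' * E := by
    calc s⁻¹ * n ≤ 1 * E := by rw [one_mul, hE]; linarith
      _ ≤ _ := by gcongr; exact (one_le_div hC').mpr hK
  calc ‖(⟨u, hu0⟩ : P.Hs 0)‖
      ≤ 2 * (4 ^ μ * (1 + l ^ 2) ^ (-μ) * ‖(⟨_, hw0⟩ : P.Hs 0)‖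
        + 2 * ((1 + l ^ 2) ^ (γ - μ) * s⁻¹) * n) := b2
    _ = 2 * (4 ^ μ * (1 + l ^ 2) ^ (-μ) * ‖(⟨_, hw0⟩ : P.Hs 0)‖
        + 2 * (1 + l ^ 2) ^ (γ - μ) * (s⁻¹ * n)) := by ring
    _ ≤ 2 * (4 ^ μ * (1 + l ^ 2) ^ (-μ) * (4 * K * (1 + l ^ 2) ^ γ * ((1 + ‖Q‖) * E))
        + 2 * (1 + l ^ 2) ^ (γ - μ) * (K / C' * E)) := by gcongr
    _ = _ := by rw [e2]; ring

end NonnegOperator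
end DampedWave

end

theorem mainTheorem1 {H : Type*} [NormedAddCommGroup H] [InnerProductSpace ℂ H] [CompleteSpace H]
    {Y : Type*} [NormedAddCommGroup Y] [InnerProductSpace ℂ Y] [CompleteSpace Y]
    (P : DampedWave.NonnegOperator H) (γ : ℝ) (hγ₀ : 0 ≤ γ) (hγ : γ ≤ 1 / 2) (Q : P.Hs γ →L[ℂ] Y) :
    (∀ (μ : ℝ) (hμ : 0 ≤ μ) (M m : ℝ → ℝ), P.ControlEstimate hγ Q μ hμ M m →
      ∃ l₀ > 0, ∃ C > 0, ∀ l : ℝ, l₀ ≤ |l| →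
        DampedWave.ResolventBound (P.generator hγ Q) (Complex.I * l)
          (C * |l| ^ (4 * μ) * (M |l| ^ 2 + m |l| ^ 2))) ∧
    (∀ (l₀ : ℝ) (_ : 0 ≤ l₀) (K : ℝ → ℝ) (_ : ∃ C' > 0, ∀ t ≥ l₀, C' ≤ K t),
      (∀ l : ℝ, l₀ ≤ |l| → DampedWave.ResolventBound (P.generator hγ Q) (Complex.I * l) (K |l|)) →
      ∀ (μ : ℝ) (hμ₀ : 0 ≤ μ) (_ : μ ≤ 1 / 2 + γ), ∃ C > 0, ∀ l ≥ l₀,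
        ∀ (u : P.Hs (1 / 2 + μ)) (hu : P.opSub (l ^ 2) (P.Lam (μ - γ) u) ∈ P.Hs 0),
          ‖(⟨u, P.mem_of_le (by linarith) u.2⟩ : P.Hs 0)‖ ≤
            C * √(1 + l ^ 2) ^ (2 * (γ - μ)) * K |l| *
              ((√(1 + l ^ 2))⁻¹ *
                  ‖(⟨P.opSub (l ^ 2) (P.Lam (μ - γ) u), hu⟩ : P.Hs 0)‖ +
                ‖Q ⟨P.Lam μ u, P.Lam_mem (by linarith) u.2⟩‖)) := by
  refine ⟨fun μ hμ M m h => P.resolventBound_of_controlEstimate hγ Q hγ₀ hμ h, ?_⟩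
  rintro l₀ hl₀ K ⟨C', hC', hK⟩ h μ hμ hμγ
  refine ⟨2 * (4 * 4 ^ μ * (1 + ‖Q‖) + 2 / C'), by positivity, fun l hl u hu => ?_⟩
  have hl' : l ≤ |l| := le_abs_self l
  exact P.control_of_resolventBound hγ Q hγ₀ hC' hμ hμγ (hK |l| (hl.le.trans hl'))
    (h l (hl.le.trans hl')) u.2 _ _ hu
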